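/- \textbf{Definitions.} A \emph{family} in a set $X$ is a function $i\mapsto x_i\in X$ on a countable index set $I$; two families that differ by a bijection of index sets are the same. Let $\Sigma$ be a partial function from families in $X$ to $X$; a family is \emph{summable} if $\Sigma$ is defined on it. $(X,\Sigma)$ is a \emph{weak $\Sigma$-monoid} if: (1) every one-element family $\{x\}$ is summable with sum $x$; (2) the empty family is summable, with sum denoted $0$, and deleting all terms equal to $0$ from a summable family leaves a summable family; (3) (bracketing) if $\{\mathbf x_j\}_{j\in J}$ is a countable collection of finite summable families and $\Sigma\biguplus_j\mathbf x_j$ is defined with value $x$, then $\Sigma\{\Sigma\mathbf x_j\}_{j\in J}$ is defined with value $x$; (4) (flattening) if $J$ is finite, each $\mathbf x_j$ is summable and $\Sigma\{\Sigma\mathbf x_j\}_{j\in J}$ is defined with value $x$, then $\Sigma\biguplus_j\mathbf x_j$ is defined with value $x$. It is \emph{strong} if moreover every subfamily of a summable family is summable, (3) holds for arbitrary (countable) summable $\mathbf x_j$, and (4) holds for arbitrary countable $J$. It is \emph{finitely total} if every finite family is summable. It is a \emph{$\Sigma$-group} if it is finitely total and there is a map $x\mapsto -x$ with $\Sigma\{x,-x\}=0$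 for all $x$ that is a $\Sigma$-homomorphism. A function $f:X\to Y$ is a \emph{$\Sigma$-homomorphism} if, whenever $\{x_i\}$ is summable with sum $x$, $\{f(x_i)\}$ is summable with sum $f(x)$. A function $f:X\times Y\to Z$ is \emph{$\Sigma$-bilinear} if all $f(x,-)$ and $f(-,y)$ are $\Sigma$-homomorphisms. Let $\mathcal C$ be any one of the four categories of weak, strong, finitely total $\Sigma$-monoids or $\Sigma$-groups, with $\Sigma$-homomorphisms as morphisms. A \emph{tensor product} of $X,Y\in\mathcal C$ is an object $X\otimes Y\in\mathcal C$ with a $\Sigma$-bilinear function $p:X\times Y\to X\otimes Y$ such that for every $W\in\mathcal C$ every $\Sigma$-bilinear $f:X\times Y\to W$ equals $g\circ p$ for a unique $\Sigma$-homomorphism $g:X\otimes Y\to W$. Let $I=\{0,1\},\{0,1\},\mathbb N,\mathbb Z$ in the weak, strong, finitely total and group case respectively, where a family is summable iff it has only finitely many nonzero terms and their usual sum lies in $I$, and that is then its sum. For $n\in I$ and $x\in X$ let $n\cdot x$ be the sum of the family of $n$ copies of $x$ (of $|n|$ copies of $-x$ if $n<0$). \textbf{Theorem.} For each of the four categories $\mathcal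 C$: (a) Any two objects $X,Y$ of $\mathcal C$ have a tensor product in $\mathcal C$. (b) For $X,Y\in\mathcal C$, the set $[X,Y]$ of $\Sigma$-homomorphisms $X\to Y$ is an object of $\mathcal C$ under the pointwise partial sum: $\{f_i\}$ is summable with sum $g\in[X,Y]$ iff, for every $x\in X$, $\{f_i(x)\}$ is summable in $Y$ with sum $g(x)$. (c) For every choice of tensor products $(X\otimes Y,p)$ for all pairs of objects, $\mathcal C$ is a closed symmetric monoidal category with monoidal product $\otimes$, unit $I$ and internal hom $[-,-]$, whose structure satisfies $(f\otimes g)(p(x,y))=p(f(x),g(y))$, $\lambda(p(n,x))=n\cdot x$, $\rho(p(x,n))=n\cdot x$ (in particular these sums are defined), $\alpha(p(p(x,y),z))=p(x,p(y,z))$ and $\beta(p(x,y))=p(y,x)$, and whose evaluation $X\otimes[X,Y]\to Y$ satisfies $p(x,h)\mapsto h(x)$. -/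

import Mathlib

open CategoryTheory MonoidalCategory

universe u

namespace SigmaMonoid

/-! ### Partial infinitary sums and the four flavours of `Σ`-monoids -/

/-- The partial value determined by a predicate that holds of at most one element. -/
noncomputable def partOf {X : Type*} (P : X → Prop) : Part X :=
  ⟨∃ x, P x, fun h => h.choose⟩

theorem mem_partOf {X : Type*} {P : X → Prop} (hP : ∀ x y, P x → P y → x = y) {x : X} :
    x ∈ partOf P ↔ P x := by
  constructor
  · rintro ⟨h, rfl⟩
    exact h.choose_spec
  · intro h
    exact ⟨⟨x, h⟩, hP _ _ (Exists.choose_spec (⟨x, h⟩ : ∃ x, P x)) h⟩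

/-- A partial function `Σ` on the countable families of elements of `X`. Families are functions
on a countable index type, and two families that differ by a bijection of the index types are the
same family, so `Σ` has to take equal (partial) values on them.
`x ∈ sum f` says that `f` is summable with sum `x`; `(sum f).Dom` says that `f` is summable. -/
class PartialSum (X : Type u) where
  sum : ∀ {ι : Type} [Countable ι], (ι → X) → Part X
  sum_reindex : ∀ {ι κ : Type} [Countable ι] [Countable κ] (e : ι ≃ κ) (f : κ → X),
    sum (fun i => f (e i)) = sum f

open PartialSum (sum)

/-- `z` is the sum of the empty family. -/
def IsZero {X : Type u} [PartialSum X] (z : X) : Prop :=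
  z ∈ sum (fun i : Empty => (i.elim : X))

/-- `x'` is an inverse of `x`: the family `{x, x'}` is summable and its sum is the zero. -/
def IsNeg {X : Type u} [PartialSum X] (x x' : X) : Prop :=
  ∃ z : X, IsZero z ∧ z ∈ sum ![x, x']

/-- `Σ`-homomorphism condition. -/
def IsSigmaHom {X Y : Type u} [PartialSum X] [PartialSum Y] (f : X → Y) : Prop :=
  ∀ {ι : Type} [Countable ι] (a : ι → X) (x : X), x ∈ sum a → f x ∈ sum (fun i => f (a i))

/-- Weak `Σ`-monoids. A disjoint union of families is indexed by a `Sigma` type. -/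
structure IsWeak (X : Type u) [PartialSum X] : Prop where
  singleton : ∀ x : X, x ∈ sum (fun _ : Unit => x)
  neutral : ∃ z : X, IsZero z ∧
    ∀ {ι : Type} [Countable ι] (f : ι → X), (sum f).Dom →
      (sum (fun i : {i : ι // f i ≠ z} => f i)).Dom
  bracketing : ∀ {J : Type} [Countable J] {K : J → Type} [∀ j, Finite (K j)]
    (f : (Σ j, K j) → X) (s : J → X), (∀ j, s j ∈ sum (fun k : K j => f ⟨j, k⟩)) →
      ∀ x : X, x ∈ sum f → x ∈ sum s
  flattening : ∀ {J : Type} [Finite J] {K : J → Type} [∀ j, Countable (K j)]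
    (f : (Σ j, K j) → X) (s : J → X), (∀ j, s j ∈ sum (fun k : K j => f ⟨j, k⟩)) →
      ∀ x : X, x ∈ sum s → x ∈ sum f

/-- Strong `Σ`-monoids. -/
structure IsStrong (X : Type u) [PartialSum X] : Prop extends IsWeak X where
  subsummability : ∀ {ι : Type} [Countable ι] (f : ι → X), (sum f).Dom →
    ∀ J : Set ι, (sum (fun j : J => f j)).Dom
  strong_bracketing : ∀ {J : Type} [Countable J] {K : J → Type} [∀ j, Countable (K j)]
    (f : (Σ j, K j) → X) (s : J → X), (∀ j, s j ∈ sum (fun k : K j => f ⟨j, k⟩)) →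
      ∀ x : X, x ∈ sum f → x ∈ sum s
  strong_flattening : ∀ {J : Type} [Countable J] {K : J → Type} [∀ j, Countable (K j)]
    (f : (Σ j, K j) → X) (s : J → X), (∀ j, s j ∈ sum (fun k : K j => f ⟨j, k⟩)) →
      ∀ x : X, x ∈ sum s → x ∈ sum f

/-- Finitely total `Σ`-monoids. -/
structure IsFinitelyTotal (X : Type u) [PartialSum X] : Prop extends IsWeak X where
  summable_of_finite : ∀ {ι : Type} [Finite ι] (f : ι → X), (sum f).Dom

/-- `Σ`-groups. -/
structure IsSigmaGroup (X : Type u) [PartialSum X] : Prop extends IsFinitelyTotal X where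
  exists_neg : ∃ neg : X → X, (∀ x, IsNeg x (neg x)) ∧ IsSigmaHom neg

/-- The four flavours of `Σ`-monoids. -/
inductive Flavour
  | weak
  | strong
  | finitelyTotal
  | group

/-- `X` with its partial sum is a `Σ`-monoid of the given flavour. -/
def Flavour.Holds (k : Flavour) (X : Type u) [PartialSum X] : Prop :=
  match k with
  | .weak => IsWeak X
  | .strong => IsStrong X
  | .finitelyTotal => IsFinitelyTotal X
  | .group => IsSigmaGroup X

/-! ### The categories -/

/-- Objects: `Σ`-monoids of flavour `k`. -/
structure SCat (k : Flavour) where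
  carrier : Type u
  [partialSum : PartialSum carrier]
  holds : k.Holds carrier

instance (k : Flavour) : CoeSort (SCat.{u} k) (Type u) := ⟨SCat.carrier⟩

instance {k : Flavour} (X : SCat.{u} k) : PartialSum X := X.partialSum

/-- `Σ`-homomorphisms. -/
@[ext]
structure SigmaHom (X Y : Type u) [PartialSum X] [PartialSum Y] where
  toFun : X → Y
  isSigmaHom : IsSigmaHom toFun

instance {X Y : Type u} [PartialSum X] [PartialSum Y] : FunLike (SigmaHom X Y) X Y where
  coe := SigmaHom.toFun
  coe_injective _ _ h := SigmaHom.ext h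

instance (k : Flavour) : Category.{u} (SCat.{u} k) where
  Hom X Y := SigmaHom X Y
  id X := ⟨fun x => x, fun _ _ h => h⟩
  comp f g := ⟨fun x => g.toFun (f.toFun x), fun a x h => g.isSigmaHom _ _ (f.isSigmaHom a x h)⟩

instance (k : Flavour) : ConcreteCategory (SCat.{u} k) (fun X Y => SigmaHom X Y) where
  hom f := f
  ofHom f := f

/-! ### `Σ`-bilinear functions and tensor products -/

/-- `Σ`-bilinear functions `X × Y → Z`. -/
structure SigmaBilinear (X Y Z : Type u) [PartialSum X] [PartialSum Y] [PartialSum Z] where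
  toFun : X → Y → Z
  isSigmaHom_right : ∀ x, IsSigmaHom (fun y => toFun x y)
  isSigmaHom_left : ∀ y, IsSigmaHom (fun x => toFun x y)

instance {X Y Z : Type u} [PartialSum X] [PartialSum Y] [PartialSum Z] :
    CoeFun (SigmaBilinear X Y Z) (fun _ => X → Y → Z) := ⟨SigmaBilinear.toFun⟩

/-- An object of the category together with a `Σ`-bilinear function from `X × Y` to it. -/
structure BilinearFrom {k : Flavour} (X Y : SCat.{u} k) where
  obj : SCat.{u} k
  map : SigmaBilinear X Y obj

/-- `T` is a tensor product of `X` and `Y`: every `Σ`-bilinear function on `X × Y` with values in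
an object of the category factors through `T` by a unique `Σ`-homomorphism. -/
def BilinearFrom.IsTensorProduct {k : Flavour} {X Y : SCat.{u} k} (T : BilinearFrom X Y) : Prop :=
  ∀ (W : SCat.{u} k) (f : SigmaBilinear X Y W),
    ∃! g : T.obj ⟶ W, ∀ (x : X) (y : Y), g (T.map x y) = f x y

/-! ### The pointwise partial sum on `Σ`-homomorphisms -/

/-- `F` is summable with sum `g` iff, at each `x`, the family `F i x` is summable with sum
`g x`. -/
noncomputable instance homSum {X Y : Type u} [PartialSum X] [PartialSum Y] :
    PartialSum (SigmaHom X Y) where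
  sum F := partOf fun g : SigmaHom X Y => ∀ x, g x ∈ sum (fun i => F i x)
  sum_reindex e F := by
    congr 1
    funext g
    exact propext (forall_congr' fun x => by
      rw [PartialSum.sum_reindex e (fun i => F i x)])

theorem mem_homSum {X Y : Type u} [PartialSum X] [PartialSum Y] {ι : Type} [Countable ι]
    (F : ι → SigmaHom X Y) (g : SigmaHom X Y) :
    g ∈ sum F ↔ ∀ x, g x ∈ sum (fun i => F i x) :=
  mem_partOf fun _ _ h h' => DFunLike.ext _ _ fun x => Part.mem_unique (h x) (h' x)

/-- The `Σ`-homomorphisms `X → Y` with the pointwise partial sum, as an object, given that they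
form a `Σ`-monoid of the right flavour. -/
noncomputable def homObj {k : Flavour} (X Y : SCat.{u} k) (h : k.Holds (SigmaHom X Y)) :
    SCat.{u} k :=
  ⟨SigmaHom X Y, h⟩

/-! ### The tensor units -/

/-- The underlying set of the tensor unit: `{0, 1}`, `{0, 1}`, `ℕ` or `ℤ`. -/
def Flavour.unitSet : Flavour → Set ℤ
  | .weak => {0, 1}
  | .strong => {0, 1}
  | .finitelyTotal => {n | 0 ≤ n}
  | .group => Set.univ

/-- The finitely supported family `f` of integers has sum `m`. -/
def FinSum {ι : Type} (f : ι → ℤ) (m : ℤ) : Prop :=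
  f.support.Finite ∧ ∑ᶠ i, f i = m

theorem FinSum.unique {ι : Type} {f : ι → ℤ} {m n : ℤ} (h : FinSum f m) (h' : FinSum f n) :
    m = n := h.2.symm.trans h'.2

theorem finSum_reindex {ι κ : Type} (e : ι ≃ κ) (f : κ → ℤ) (m : ℤ) :
    FinSum (fun i => f (e i)) m ↔ FinSum f m := by
  have h1 : (fun i => f (e i)).support.Finite ↔ f.support.Finite := by
    constructor
    · intro h
      refine (h.image e).subset fun k hk => ⟨e.symm k, ?_, by simp⟩
      simpa using hk
    · intro h
      exact h.preimage e.injective.injOn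
  unfold FinSum
  rw [h1, finsum_comp_equiv e]

theorem finSum_singleton {ι : Type} [Unique ι] (m : ℤ) : FinSum (fun _ : ι => m) m :=
  ⟨Set.toFinite _, by rw [finsum_unique]⟩

theorem finSum_empty {ι : Type} [IsEmpty ι] (f : ι → ℤ) : FinSum f 0 :=
  ⟨Set.toFinite _, by rw [finsum_of_isEmpty]⟩

theorem FinSum.sub {ι : Type} {f : ι → ℤ} {m : ℤ} (h : FinSum f m) (s : Set ι) :
    FinSum (fun i : s => f i) (∑ᶠ i : s, f i) :=
  ⟨h.1.preimage Subtype.val_injective.injOn, rfl⟩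

/-- If `f` is finitely supported, so are its restrictions and the family of their sums, and the
total sums agree. -/
theorem finSum_bracketing {J : Type} {K : J → Type} (f : (Σ j, K j) → ℤ) (s : J → ℤ)
    (hs : ∀ j, FinSum (fun k => f ⟨j, k⟩) (s j)) {m : ℤ} (hf : FinSum f m) : FinSum s m := by
  classical
  obtain ⟨hf, rfl⟩ := hf
  have hJ : s.support ⊆ ((hf.image Sigma.fst).toFinset : Set J) := by
    intro j hj
    by_contra hc
    apply hj
    rw [← (hs j).2]
    have : (fun k => f ⟨j, k⟩) = fun _ => 0 := by
      funext k
      by_contra hk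
      exact hc (by simpa using ⟨_, hk⟩)
    rw [this, finsum_zero]
  refine ⟨(Finset.finite_toSet _).subset hJ, ?_⟩
  rw [finsum_eq_sum_of_support_subset s hJ]
  have key : ∀ j, s j = ∑ k ∈ (hs j).1.toFinset, f ⟨j, k⟩ := fun j => by
    exact (hs j).2.symm.trans
      (finsum_eq_sum_of_support_subset _ (Set.Finite.coe_toFinset (hs j).1).ge)
  simp_rw [key]
  rw [← Finset.sum_sigma (hf.image Sigma.fst).toFinset (fun j => (hs j).1.toFinset) f]
  symm
  apply finsum_eq_sum_of_support_subset
  rintro ⟨j, k⟩ hjk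
  simp only [Finset.coe_sigma, Set.mem_sigma_iff, Finset.mem_coe, Set.Finite.mem_toFinset,
    Set.mem_image]
  exact ⟨⟨⟨j, k⟩, hjk, rfl⟩, hjk⟩

/-- If only finitely many of the restrictions of `f` are not identically zero, and these are
finitely supported, then `f` is. -/
theorem finSum_flattening {J : Type} {K : J → Type} (f : (Σ j, K j) → ℤ) (s : J → ℤ)
    (hs : ∀ j, FinSum (fun k => f ⟨j, k⟩) (s j)) (hJ : {j | ∃ k, f ⟨j, k⟩ ≠ 0}.Finite)
    {m : ℤ} (hm : FinSum s m) : FinSum f m := by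
  have hf : f.support.Finite := by
    refine (hJ.biUnion fun j _ => (hs j).1.image (Sigma.mk j)).subset ?_
    rintro ⟨j, k⟩ hjk
    exact Set.mem_biUnion (x := j) ⟨k, hjk⟩ ⟨k, hjk, rfl⟩
  have := finSum_bracketing f s hs (m := ∑ᶠ i, f i) ⟨hf, rfl⟩
  exact ⟨hf, this.unique hm⟩

/-- The underlying type of the tensor unit, in an arbitrary universe. -/
abbrev UnitCarrier (k : Flavour) : Type u := ULift.{u} k.unitSet

/-- The integer that an element of the tensor unit is. -/
def UnitCarrier.val {k : Flavour} (n : UnitCarrier.{u} k) : ℤ := n.down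

theorem UnitCarrier.val_injective {k : Flavour} :
    Function.Injective (UnitCarrier.val : UnitCarrier.{u} k → ℤ) :=
  fun _ _ h => ULift.ext _ _ (Subtype.ext h)

/-- A family in the tensor unit is summable iff it has finitely many nonzero terms and their sum
lies in the underlying set; that sum is then its sum. -/
noncomputable instance unitSum (k : Flavour) : PartialSum (UnitCarrier.{u} k) where
  sum f := partOf fun n : UnitCarrier.{u} k => FinSum (fun i => (f i).val) n.val
  sum_reindex e f := by
    congr 1
    funext n
    exact propext (finSum_reindex e (fun i => (f i).val) n.val)

theorem mem_unitSum {k : Flavour} {ι : Type} [Countable ι] (f : ι → UnitCarrier.{u} k)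
    (n : UnitCarrier.{u} k) : n ∈ sum f ↔ FinSum (fun i => (f i).val) n.val :=
  mem_partOf fun _ _ h h' => UnitCarrier.val_injective (h.unique h')

theorem unitSum_dom {k : Flavour} {ι : Type} [Countable ι] (f : ι → UnitCarrier.{u} k) {m : ℤ}
    (hm : m ∈ k.unitSet) (h : FinSum (fun i => (f i).val) m) : (sum f).Dom :=
  ((mem_unitSum f ⟨⟨m, hm⟩⟩).2 h).1

theorem unit_isWeak (k : Flavour) : IsWeak (UnitCarrier.{u} k) where
  singleton x := (mem_unitSum _ _).2 (finSum_singleton _)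
  neutral := by
    have h0 : (0 : ℤ) ∈ k.unitSet := by cases k <;> simp [Flavour.unitSet]
    refine ⟨⟨⟨0, h0⟩⟩, (mem_unitSum _ _).2 (finSum_empty _), ?_⟩
    intro ι _ f hf
    obtain ⟨n, hn⟩ := Part.dom_iff_mem.1 hf
    rw [mem_unitSum] at hn
    refine unitSum_dom _ n.down.2 (m := n.val) ⟨(hn.sub _).1, ?_⟩
    rw [← hn.2]
    change ∑ᶠ i : ({i | f i ≠ ⟨⟨0, h0⟩⟩} : Set ι), (f i).val = _
    rw [finsum_subtype_eq_finsum_cond (f := fun i => (f i).val)]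
    refine finsum_congr fun i => ?_
    by_cases hi : f i = ⟨⟨0, h0⟩⟩
    · simp [hi, UnitCarrier.val]
    · simp [hi]
  bracketing f s hs x hx := by
    rw [mem_unitSum] at hx ⊢
    exact finSum_bracketing _ _ (fun j => (mem_unitSum _ _).1 (hs j)) hx
  flattening f s hs x hx := by
    rw [mem_unitSum] at hx ⊢
    exact finSum_flattening _ _ (fun j => (mem_unitSum _ _).1 (hs j)) (Set.toFinite _) hx

theorem unit_summable_of_finite {k : Flavour} (hk : k = .finitelyTotal ∨ k = .group)
    {ι : Type} [Finite ι] (f : ι → UnitCarrier.{u} k) : (sum f).Dom := by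
  refine unitSum_dom f (m := ∑ᶠ i, (f i).val) ?_ ⟨Set.toFinite _, rfl⟩
  rcases hk with rfl | rfl
  · exact finsum_nonneg (f := fun i => (f i).val) fun i => (f i).down.2
  · trivial

theorem unit_isStrong : IsStrong (UnitCarrier.{u} .strong) where
  toIsWeak := unit_isWeak _
  subsummability {ι} _ f hf J := by
    obtain ⟨n, hn⟩ := Part.dom_iff_mem.1 hf
    rw [mem_unitSum] at hn
    have h0 : ∀ i, 0 ≤ (f i).val := fun i => by
      have h : (f i).val = 0 ∨ (f i).val = 1 := (f i).down.2
      omega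
    refine unitSum_dom _ ?_ (hn.sub J)
    have h1 : 0 ≤ ∑ᶠ i : J, (f i).val := finsum_nonneg fun i => h0 i
    have h2 : ∑ᶠ i : J, (f i).val ≤ n.val := by
      obtain ⟨hn1, hn2⟩ := hn
      rw [← hn2, finsum_subtype_eq_finsum_cond (f := fun i => (f i).val) (· ∈ J)]
      have hle : ∀ i, ∑ᶠ _ : i ∈ J, (f i).val ≤ (f i).val := fun i => by
        by_cases hi : i ∈ J <;> simp [hi, h0]
      have hsub : (fun i => ∑ᶠ _ : i ∈ J, (f i).val).support ⊆ hn1.toFinset := by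
        intro i hi
        rw [Set.Finite.coe_toFinset]
        intro hz
        apply hi
        simp [hz]
      rw [finsum_eq_sum_of_support_subset _ hsub,
        finsum_eq_sum_of_support_subset _ (Set.Finite.coe_toFinset hn1).ge]
      exact Finset.sum_le_sum fun i _ => hle i
    have h3 : n.val ≤ 1 := by
      have h : n.val = 0 ∨ n.val = 1 := n.down.2
      omega
    change _ = _ ∨ _ = _
    omega
  strong_bracketing f s hs x hx := by
    rw [mem_unitSum] at hx ⊢
    exact finSum_bracketing _ _ (fun j => (mem_unitSum _ _).1 (hs j)) hx
  strong_flattening {J} _ {K} _ f s hs x hx := by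
    rw [mem_unitSum] at hx ⊢
    have h0 : ∀ i, 0 ≤ (f i).val := fun i => by
      have h : (f i).val = 0 ∨ (f i).val = 1 := (f i).down.2
      omega
    refine finSum_flattening _ _ (fun j => (mem_unitSum _ _).1 (hs j)) (hx.1.subset ?_) hx
    rintro j ⟨k, hk⟩ hz
    have hj := (mem_unitSum _ _).1 (hs j)
    have := single_le_finsum k hj.1 (fun k => h0 ⟨j, k⟩)
    rw [hj.2] at this
    change (s j).val = 0 at hz
    have := h0 ⟨j, k⟩
    omega

theorem unit_isFinitelyTotal : IsFinitelyTotal (UnitCarrier.{u} .finitelyTotal) where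
  toIsWeak := unit_isWeak _
  summable_of_finite f := unit_summable_of_finite (Or.inl rfl) f

theorem unit_isSigmaGroup : IsSigmaGroup (UnitCarrier.{u} .group) where
  toIsWeak := unit_isWeak _
  summable_of_finite f := unit_summable_of_finite (Or.inr rfl) f
  exists_neg := by
    refine ⟨fun n => ⟨⟨-n.val, trivial⟩⟩, fun n => ⟨⟨⟨0, trivial⟩⟩, ?_, ?_⟩, ?_⟩
    · exact (mem_unitSum _ _).2 (finSum_empty _)
    · rw [mem_unitSum]
      refine ⟨Set.toFinite _, ?_⟩
      rw [finsum_eq_sum_of_fintype, Fin.sum_univ_two]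
      simp [UnitCarrier.val]
    · intro ι _ a x hx
      rw [mem_unitSum] at hx ⊢
      refine ⟨hx.1.subset ?_, ?_⟩
      · intro i hi hz
        apply hi
        simpa [UnitCarrier.val] using hz
      · change ∑ᶠ i, -(a i).val = -x.val
        rw [finsum_neg_distrib, hx.2]

/-- The tensor unit. -/
noncomputable def unitObj : (k : Flavour) → SCat.{u} k
  | .weak => ⟨UnitCarrier.{u} .weak, unit_isWeak _⟩
  | .strong => ⟨UnitCarrier.{u} .strong, unit_isStrong⟩
  | .finitelyTotal => ⟨UnitCarrier.{u} .finitelyTotal, unit_isFinitelyTotal⟩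
  | .group => ⟨UnitCarrier.{u} .group, unit_isSigmaGroup⟩

/-- The integer that an element of the tensor unit is. -/
def unitVal : {k : Flavour} → unitObj.{u} k → ℤ
  | .weak => fun n => UnitCarrier.val n
  | .strong => fun n => UnitCarrier.val n
  | .finitelyTotal => fun n => UnitCarrier.val n
  | .group => fun n => UnitCarrier.val n

/-- `y` is the sum of the family of `n` copies of `x` if `n ≥ 0`, and of `|n|` copies of the
inverse of `x` if `n < 0`. -/
def IsMultiple {X : Type u} [PartialSum X] (n : ℤ) (x y : X) : Prop :=
  (0 ≤ n ∧ y ∈ sum (fun _ : Fin n.natAbs => x)) ∨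
    (n < 0 ∧ ∃ x' : X, IsNeg x x' ∧ y ∈ sum (fun _ : Fin n.natAbs => x'))

end SigmaMonoid

/-!
The tensor product is the part generated by the pure tensors inside the product of the codomains
of all `Σ`-bilinear functions on `X × Y`. There is a proper class of factors, but the elements of
that part are values of countably branching expressions in pure tensors, so they form a set.
Sums are formed componentwise, hence inherit the axioms from the factors.

A pointwise sum of `Σ`-homomorphisms is a `Σ`-homomorphism because two sums may be interchanged:
always if one of them is finite, and for countable sums by the strong axioms. This makes `[X, Y]`
an object.

The unit represents the underlying set: `f ↦ f 1` is a bijection from the `Σ`-homomorphisms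
`I → X` to `X`. The homomorphism `I → [X, X]` with `1 ↦ id` is the action `n · x`, and it induces
the unitors. All coherence conditions compare `Σ`-homomorphisms out of iterated tensor products, so
they may be checked on pure tensors.
-/

universe v

namespace SigmaMonoid

open PartialSum (sum)

section Sums

variable {X Y : Type u} [PartialSum X] [PartialSum Y] {ι κ : Type} [Countable ι] [Countable κ]

theorem mem_sum_reindex (e : ι ≃ κ) {a : κ → X} {x : X} :
    x ∈ sum (fun i => a (e i)) ↔ x ∈ sum a := by
  rw [PartialSum.sum_reindex]

theorem isZero_iff_mem_sum {α : Type} [IsEmpty α] (a : α → X) {z : X} :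
    IsZero z ↔ z ∈ sum a := by
  rw [IsZero, ← mem_sum_reindex (Equiv.equivEmpty α), Subsingleton.elim a]

theorem IsZero.unique {x y : X} (hx : IsZero x) (hy : IsZero y) : x = y :=
  Part.mem_unique hx hy

theorem mem_sum_pair_iff_bool {x y z : X} :
    x ∈ sum ![y, z] ↔ x ∈ sum (fun b : Bool => bif b then z else y) := by
  rw [← mem_sum_reindex finTwoEquiv]
  exact iff_of_eq (congrArg (fun a => x ∈ sum a) (List.ofFn_injective rfl))

theorem mem_sum_pair_comm {x y z : X} : x ∈ sum ![y, z] ↔ x ∈ sum ![z, y] := by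
  rw [← mem_sum_reindex (Equiv.swap (0 : Fin 2) 1)]
  exact iff_of_eq (congrArg (fun a => x ∈ sum a) (List.ofFn_injective rfl))

theorem mem_sum_map_pair {S : Type*} {f : S → X} {x : X} {y z : S} :
    x ∈ sum (fun i => f (![y, z] i)) ↔ x ∈ sum ![f y, f z] :=
  iff_of_eq (congrArg (fun a => x ∈ sum a) (List.ofFn_injective rfl))

theorem mem_sum_sigma_comm {a : ι → κ → X} {x : X} :
    x ∈ sum (fun p : Σ _ : ι, κ => a p.1 p.2) ↔ x ∈ sum (fun p : Σ _ : κ, ι => a p.2 p.1) :=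
  (mem_sum_reindex ((Equiv.sigmaEquivProd κ ι).trans
    ((Equiv.prodComm κ ι).trans (Equiv.sigmaEquivProd ι κ).symm))).symm

theorem IsSigmaHom.map_isZero {f : X → Y} (hf : IsSigmaHom f) {z : X} (hz : IsZero z) :
    IsZero (f z) :=
  (isZero_iff_mem_sum _).2 (hf _ _ hz)

theorem IsSigmaHom.map_isNeg {f : X → Y} (hf : IsSigmaHom f) {x x' : X} (h : IsNeg x x') :
    IsNeg (f x) (f x') :=
  let ⟨z, hz, hsum⟩ := h
  ⟨f z, hf.map_isZero hz, mem_sum_map_pair.1 (hf _ _ hsum)⟩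

theorem IsSigmaHom.map_isMultiple {f : X → Y} (hf : IsSigmaHom f) {n : ℤ} {x y : X}
    (h : IsMultiple n x y) : IsMultiple n (f x) (f y) := by
  rcases h with ⟨hn, h⟩ | ⟨hn, x', hx', h⟩
  · exact Or.inl ⟨hn, hf _ _ h⟩
  · exact Or.inr ⟨hn, f x', hf.map_isNeg hx', hf _ _ h⟩

end Sums

namespace IsWeak

variable {X : Type u} [PartialSum X] {ι κ : Type} [Countable ι] [Countable κ]

theorem exists_isZero (hX : IsWeak X) : ∃ z : X, IsZero z :=
  let ⟨z, hz, _⟩ := hX.neutral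
  ⟨z, hz⟩

theorem mem_sum_of_unique (hX : IsWeak X) {α : Type} [Unique α] (a : α → X) :
    a default ∈ sum a := by
  rw [← mem_sum_reindex (Equiv.ofUnique Unit α)]
  exact hX.singleton (a default)

theorem mem_sum_of_mem_sum_subtype (hX : IsWeak X) {z : X} (hz : IsZero z) {a : ι → X}
    {p : ι → Prop} (ha : ∀ i, ¬ p i → a i = z) {x : X}
    (hx : x ∈ sum (fun i : {i // p i} => a i)) : x ∈ sum a := by
  rw [← mem_sum_reindex (Equiv.sigmaPLiftEquivSubtype p)] at hx
  refine hX.bracketing (K := fun i => PLift (p i)) _ a (fun i => ?_) x hx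
  by_cases hi : p i
  · have : Unique (PLift (p i)) := ⟨⟨⟨hi⟩⟩, fun _ => rfl⟩
    exact hX.mem_sum_of_unique fun _ : PLift (p i) => a i
  · have : IsEmpty (PLift (p i)) := ⟨fun h => hi h.down⟩
    rw [ha i hi]
    exact (isZero_iff_mem_sum _).1 hz

theorem mem_sum_subtype_ne_zero (hX : IsWeak X) {z : X} (hz : IsZero z) {a : ι → X} {x : X}
    (hx : x ∈ sum a) : x ∈ sum (fun i : {i // a i ≠ z} => a i) := by
  obtain ⟨z', hz', hdel⟩ := hX.neutral
  obtain rfl := hz.unique hz'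
  obtain ⟨y, hy⟩ := Part.dom_iff_mem.1 (hdel a (Part.dom_iff_mem.2 ⟨x, hx⟩))
  have hya : y ∈ sum a := hX.mem_sum_of_mem_sum_subtype hz (fun i hi => not_not.1 hi) hy
  rwa [Part.mem_unique hx hya]

theorem mem_sum_subtype_iff (hX : IsWeak X) {z : X} (hz : IsZero z) {a : ι → X}
    {p : ι → Prop} (ha : ∀ i, ¬ p i → a i = z) {x : X} :
    x ∈ sum (fun i : {i // p i} => a i) ↔ x ∈ sum a := by
  refine ⟨hX.mem_sum_of_mem_sum_subtype hz ha, fun hx => ?_⟩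
  have hp : ∀ {i}, a i ≠ z → p i := fun {i} hi => by_contra fun h => hi (ha i h)
  refine hX.mem_sum_of_mem_sum_subtype (p := fun i : {i // p i} => a i ≠ z) hz
    (fun i hi => not_not.1 hi) ?_
  exact (mem_sum_reindex (a := fun i : {i // a i ≠ z} => a i)
    (Equiv.subtypeSubtypeEquivSubtype hp)).2 (hX.mem_sum_subtype_ne_zero hz hx)

theorem mem_sum_sumElim (hX : IsWeak X) {a : ι → X} {b : κ → X} {x y z : X} (hy : y ∈ sum a)
    (hz : z ∈ sum b) (hx : x ∈ sum ![y, z]) : x ∈ sum (Sum.elim a b) := by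
  rw [mem_sum_pair_iff_bool] at hx
  have : ∀ b : Bool, Countable (bif b then κ else ι) := by rintro (_ | _) <;> assumption
  rw [← mem_sum_reindex (Equiv.sumEquivSigmaBool ι κ).symm]
  exact hX.flattening _ _ (Bool.rec hy hz) x hx

theorem mem_sum_pair_of_mem_sum_sumElim (hX : IsWeak X) {α β : Type} [Finite α] [Finite β]
    {a : α → X} {b : β → X} {x y z : X} (hy : y ∈ sum a) (hz : z ∈ sum b)
    (hx : x ∈ sum (Sum.elim a b)) : x ∈ sum ![y, z] := by
  rw [mem_sum_pair_iff_bool]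
  have : ∀ b : Bool, Finite (bif b then β else α) := by rintro (_ | _) <;> assumption
  rw [← mem_sum_reindex (Equiv.sumEquivSigmaBool α β).symm] at hx
  exact hX.bracketing _ _ (Bool.rec hy hz) x hx

theorem mem_sum_zero_pair (hX : IsWeak X) {z : X} (hz : IsZero z) (x : X) : x ∈ sum ![z, x] := by
  refine hX.mem_sum_of_mem_sum_subtype (p := (· = 1)) hz (fun i hi => ?_)
    (hX.mem_sum_of_unique fun i : {i : Fin 2 // i = 1} => ![z, x] i)
  rw [(by lia : i = 0)]
  rfl

theorem mem_sum_pair_assoc (hX : IsWeak X) {x y z xy yz w : X} (hxy : xy ∈ sum ![x, y])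
    (hyz : yz ∈ sum ![y, z]) (hw : w ∈ sum ![xy, z]) : w ∈ sum ![x, yz] := by
  have hpair : ∀ {x y s : X}, s ∈ sum ![x, y] →
      s ∈ sum (Sum.elim (fun _ : Unit => x) fun _ : Unit => y) :=
    hX.mem_sum_sumElim (hX.singleton _) (hX.singleton _)
  refine hX.mem_sum_pair_of_mem_sum_sumElim (hX.singleton x) (hpair hyz) ?_
  rw [← mem_sum_reindex (Equiv.sumAssoc Unit Unit Unit)]
  convert hX.mem_sum_sumElim (hpair hxy) (hX.singleton z) hw using 2
  funext i
  rcases i with (_ | _) | _ <;> rfl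

theorem mem_sum_comm_of_finite (hX : IsWeak X) {α : Type} [Finite α] {a : α → κ → X}
    {r : α → X} {c : κ → X} (hr : ∀ i, r i ∈ sum (a i)) (hc : ∀ j, c j ∈ sum fun i => a i j) {x : X}
    (hx : x ∈ sum r) : x ∈ sum c := by
  have hflat : x ∈ sum fun p : Σ _ : α, κ => a p.1 p.2 := hX.flattening _ r hr x hx
  exact hX.bracketing _ c hc x (mem_sum_sigma_comm.1 hflat)

end IsWeak

theorem IsStrong.mem_sum_comm {X : Type u} [PartialSum X] (hX : IsStrong X) {ι κ : Type}
    [Countable ι] [Countable κ] {a : ι → κ → X} {r : ι → X} {c : κ → X}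
    (hr : ∀ i, r i ∈ sum (a i)) (hc : ∀ j, c j ∈ sum fun i => a i j) {x : X} (hx : x ∈ sum r) :
    x ∈ sum c :=
  hX.strong_bracketing _ c hc x (mem_sum_sigma_comm.1 (hX.strong_flattening _ r hr x hx))

/-! ### Finite sums as addition -/

/-- The partial sum of `X` extends an everywhere defined addition on `X`. -/
structure ExtendsAddition (X : Type u) [PartialSum X] [AddCommMonoid X] : Prop where
  isZero_zero : IsZero (0 : X)
  add_mem_sum : ∀ x y : X, x + y ∈ sum ![x, y]

namespace ExtendsAddition

variable {X : Type u} [PartialSum X] [AddCommMonoid X] {ι : Type}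

theorem isNeg_iff (h : ExtendsAddition X) {x y : X} : IsNeg x y ↔ x + y = 0 := by
  constructor
  · rintro ⟨z, hz, hsum⟩
    rw [← h.isZero_zero.unique hz] at hsum
    exact Part.mem_unique (h.add_mem_sum x y) hsum
  · intro hxy
    exact ⟨0, h.isZero_zero, hxy ▸ h.add_mem_sum x y⟩

theorem sum_univ_mem_sum (h : ExtendsAddition X) (hX : IsWeak X) [Fintype ι] (a : ι → X) :
    ∑ i, a i ∈ sum a := by
  revert a
  refine Fintype.induction_empty_option (P := fun ι _ => ∀ a : ι → X, ∑ i, a i ∈ sum a)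
    ?_ ?_ ?_ ι
  · intro α β _ e ih a
    let := Fintype.ofEquiv β e.symm
    rw [← mem_sum_reindex e, ← e.sum_comp]
    exact ih _
  · intro a
    rw [Fintype.sum_empty]
    exact (isZero_iff_mem_sum a).1 h.isZero_zero
  · intro α _ ih a
    rw [← mem_sum_reindex (Equiv.optionEquivSumPUnit α).symm, Fintype.sum_option, add_comm]
    convert hX.mem_sum_sumElim (ih _) (hX.mem_sum_of_unique fun _ : PUnit => a none)
      (h.add_mem_sum _ _) using 2
    funext i
    rcases i with _ | _ <;> rfl

theorem finsum_mem_sum (h : ExtendsAddition X) (hX : IsWeak X) [Countable ι] {a : ι → X}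
    (ha : a.support.Finite) : ∑ᶠ i, a i ∈ sum a := by
  rw [finsum_eq_sum a ha, ← Finset.sum_coe_sort]
  refine hX.mem_sum_of_mem_sum_subtype (p := (· ∈ ha.toFinset)) h.isZero_zero (fun i hi => ?_)
    (h.sum_univ_mem_sum hX fun i : ha.toFinset => a i)
  simpa only [Set.Finite.mem_toFinset, Function.mem_support, not_not] using hi

end ExtendsAddition

namespace IsFinitelyTotal

variable {X : Type u} [PartialSum X]

theorem exists_addCommMonoid (hX : IsFinitelyTotal X) :
    ∃ _ : AddCommMonoid X, ExtendsAddition X := by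
  obtain ⟨zero, hzero⟩ := hX.exists_isZero
  choose add hadd using fun x y : X => Part.dom_iff_mem.1 (hX.summable_of_finite ![x, y])
  have add_comm (x y : X) : add x y = add y x :=
    Part.mem_unique (hadd x y) (mem_sum_pair_comm.1 (hadd y x))
  have zero_add (x : X) : add zero x = x :=
    Part.mem_unique (hadd zero x) (hX.mem_sum_zero_pair hzero x)
  let := Zero.mk zero
  let := Add.mk add
  let addCommMonoid : AddCommMonoid X := {
    add_assoc x y z := Part.mem_unique
      (hX.mem_sum_pair_assoc (hadd x y) (hadd y z) (hadd (add x y) z)) (hadd x (add y z))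
    zero_add := zero_add
    add_zero x := (add_comm x zero).trans (zero_add x)
    add_comm := add_comm
    nsmul := nsmulRec }
  exact ⟨addCommMonoid, hzero, hadd⟩

theorem isNeg_unique (hX : IsFinitelyTotal X) {x y z : X} (hy : IsNeg x y) (hz : IsNeg x z) :
    y = z := by
  obtain ⟨_, hadd⟩ := hX.exists_addCommMonoid
  exact left_neg_eq_right_neg ((add_comm y x).trans (hadd.isNeg_iff.1 hy)) (hadd.isNeg_iff.1 hz)

end IsFinitelyTotal

theorem IsMultiple.unique {X : Type u} [PartialSum X] {n : ℤ} (hn : 0 ≤ n ∨ IsFinitelyTotal X)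
    {x y z : X} (hy : IsMultiple n x y) (hz : IsMultiple n x z) : y = z := by
  rcases hy with ⟨hn', hy⟩ | ⟨hn', x', hx', hy⟩ <;>
    rcases hz with ⟨hn'', hz⟩ | ⟨hn'', x'', hx'', hz⟩
  · exact Part.mem_unique hy hz
  · lia
  · lia
  · obtain rfl := (hn.resolve_left (by lia)).isNeg_unique hx' hx''
    exact Part.mem_unique hy hz

/-! ### Initial partial sums -/

/-- The partial sum of `T` is formed componentwise along the jointly injective maps `π i`. Unlike
for a product, a componentwise sum need not be attained in `T`. -/
structure IsInitialSum {T : Type u} [PartialSum T] {I : Type v} {W : I → Type u}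
    [∀ i, PartialSum (W i)] (π : ∀ i, T → W i) : Prop where
  ext : ∀ t t', (∀ i, π i t = π i t') → t = t'
  mem_sum_iff : ∀ {ι : Type} [Countable ι] (a : ι → T) (t : T),
    t ∈ sum a ↔ ∀ i, π i t ∈ sum (fun j => π i (a j))

/-- The partial sum on `T` formed componentwise along the maps `π i`. It is meaningful only if
these are jointly injective. -/
noncomputable abbrev initialSum {T : Type u} {I : Type v} {W : I → Type u}
    [∀ i, PartialSum (W i)] (π : ∀ i, T → W i) : PartialSum T where
  sum a := partOf fun t => ∀ i, π i t ∈ sum (fun j => π i (a j))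
  sum_reindex e a := congrArg partOf (funext fun _ => propext (forall_congr' fun i =>
    mem_sum_reindex e (a := fun j => π i (a j))))

theorem isInitialSum_initialSum {T : Type u} {I : Type v} {W : I → Type u}
    [∀ i, PartialSum (W i)] {π : ∀ i, T → W i} (ext : ∀ t t', (∀ i, π i t = π i t') → t = t') :
    letI := initialSum π
    IsInitialSum π :=
  letI := initialSum π
  { ext := ext
    mem_sum_iff := fun _ _ => mem_partOf fun _ _ h h' =>
      ext _ _ fun i => Part.mem_unique (h i) (h' i) }

namespace IsInitialSum

variable {T : Type u} [PartialSum T] {I : Type v} {W : I → Type u} [∀ i, PartialSum (W i)]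
  {π : ∀ i, T → W i}

theorem isSigmaHom (h : IsInitialSum π) (i : I) : IsSigmaHom (π i) :=
  fun _ _ ha => (h.mem_sum_iff _ _).1 ha i

theorem map_isZero (h : IsInitialSum π) {z : T} (hz : IsZero z) (i : I) : IsZero (π i z) :=
  IsSigmaHom.map_isZero (f := π i) (h.isSigmaHom i) hz

theorem isNeg_of_forall (h : IsInitialSum π) {z : T} (hz : IsZero z) {x y : T}
    (hxy : ∀ i, IsNeg (π i x) (π i y)) : IsNeg x y := by
  refine ⟨z, hz, (h.mem_sum_iff _ _).2 fun i => mem_sum_map_pair.2 ?_⟩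
  obtain ⟨z', hz', hi⟩ := hxy i
  rwa [(h.map_isZero hz i).unique hz']

section FiniteSums

variable (hfin : ∀ {ι : Type} [Finite ι] (a : ι → T),
  (∀ i, (sum fun j => π i (a j)).Dom) → (sum a).Dom)

include hfin

theorem exists_isZero (hW : ∀ i, IsWeak (W i)) : ∃ z : T, IsZero z :=
  Part.dom_iff_mem.1 <| hfin _ fun i =>
    let ⟨_, hz⟩ := (hW i).exists_isZero
    Part.dom_iff_mem.2 ⟨_, (isZero_iff_mem_sum _).1 hz⟩

theorem isWeak (h : IsInitialSum π) (hW : ∀ i, IsWeak (W i)) : IsWeak T where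
  singleton x := (h.mem_sum_iff _ _).2 fun i => (hW i).singleton _
  neutral := by
    obtain ⟨z, hz⟩ := exists_isZero hfin hW
    refine ⟨z, hz, fun f hf => ?_⟩
    obtain ⟨x, hx⟩ := Part.dom_iff_mem.1 hf
    refine Part.dom_iff_mem.2 ⟨x, (h.mem_sum_iff _ _).2 fun i => ?_⟩
    exact ((hW i).mem_sum_subtype_iff (h.map_isZero hz i)
      fun j hj => congrArg (π i) (not_not.1 hj)).2 ((h.mem_sum_iff _ _).1 hx i)
  bracketing f s hs x hx := by
    simp only [h.mem_sum_iff] at hs hx ⊢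
    exact fun i => (hW i).bracketing (fun p => π i (f p)) _ (fun j => hs j i) _ (hx i)
  flattening f s hs x hx := by
    simp only [h.mem_sum_iff] at hs hx ⊢
    exact fun i => (hW i).flattening (fun p => π i (f p)) _ (fun j => hs j i) _ (hx i)

theorem isFinitelyTotal (h : IsInitialSum π) (hW : ∀ i, IsFinitelyTotal (W i)) :
    IsFinitelyTotal T where
  toIsWeak := h.isWeak hfin fun i => (hW i).toIsWeak
  summable_of_finite _ := hfin _ fun i => (hW i).summable_of_finite _

theorem isSigmaGroup (h : IsInitialSum π) (hW : ∀ i, IsSigmaGroup (W i))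
    (hneg : ∀ t : T, ∃ t' : T, ∀ i, IsNeg (π i t) (π i t')) : IsSigmaGroup T where
  toIsFinitelyTotal := h.isFinitelyTotal hfin fun i => (hW i).toIsFinitelyTotal
  exists_neg := by
    obtain ⟨z, hz⟩ := exists_isZero hfin fun i => (hW i).toIsWeak
    choose neg hneg using hneg
    refine ⟨neg, fun x => h.isNeg_of_forall hz (hneg x), fun a x hx => ?_⟩
    refine (h.mem_sum_iff _ _).2 fun i => ?_
    obtain ⟨negW, hnegW, hhom⟩ := (hW i).exists_neg
    have hπ : ∀ t, π i (neg t) = negW (π i t) := fun t =>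
      (hW i).isNeg_unique (hneg t i) (hnegW _)
    simp only [hπ]
    exact hhom _ _ (h.isSigmaHom i _ _ hx)

end FiniteSums

theorem isStrong (hsum : ∀ {ι : Type} [Countable ι] (a : ι → T),
    (∀ i, (sum fun j => π i (a j)).Dom) → (sum a).Dom) (h : IsInitialSum π)
    (hW : ∀ i, IsStrong (W i)) : IsStrong T where
  toIsWeak := h.isWeak hsum fun i => (hW i).toIsWeak
  subsummability f hf J := hsum _ fun i =>
    let ⟨_, hx⟩ := Part.dom_iff_mem.1 hf
    (hW i).subsummability _ (Part.dom_iff_mem.2 ⟨_, h.isSigmaHom i _ _ hx⟩) J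
  strong_bracketing f s hs x hx := by
    simp only [h.mem_sum_iff] at hs hx ⊢
    exact fun i => (hW i).strong_bracketing (fun p => π i (f p)) _ (fun j => hs j i) _ (hx i)
  strong_flattening f s hs x hx := by
    simp only [h.mem_sum_iff] at hs hx ⊢
    exact fun i => (hW i).strong_flattening (fun p => π i (f p)) _ (fun j => hs j i) _ (hx i)

end IsInitialSum

theorem Flavour.Holds.isWeak {k : Flavour} {X : Type u} [PartialSum X] (h : k.Holds X) :
    IsWeak X := by
  cases k
  exacts [h, h.toIsWeak, h.toIsWeak, h.toIsWeak]

/-! ### The internal hom -/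

section Hom

variable {X Y : Type u} [PartialSum X] [PartialSum Y] {ι : Type}

theorem isSigmaHom_of_mem_sum_of_finite (hY : IsWeak Y) [Finite ι] {F : ι → X → Y}
    (hF : ∀ i, IsSigmaHom (F i)) {g : X → Y} (hg : ∀ x, g x ∈ sum fun i => F i x) :
    IsSigmaHom g :=
  fun a x ha => hY.mem_sum_comm_of_finite (fun i => hF i a x ha) (fun j => hg (a j)) (hg x)

theorem isSigmaHom_of_mem_sum (hY : IsStrong Y) [Countable ι] {F : ι → X → Y}
    (hF : ∀ i, IsSigmaHom (F i)) {g : X → Y} (hg : ∀ x, g x ∈ sum fun i => F i x) :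
    IsSigmaHom g :=
  fun a x ha => hY.mem_sum_comm (fun i => hF i a x ha) (fun j => hg (a j)) (hg x)

theorem isInitialSum_eval : IsInitialSum (fun (x : X) (f : SigmaHom X Y) => f x) where
  ext _ _ h := DFunLike.ext _ _ h
  mem_sum_iff := mem_homSum

theorem SigmaHom.sum_dom_of_finite (hY : IsWeak Y) [Finite ι] (F : ι → SigmaHom X Y)
    (hF : ∀ x, (sum fun i => F i x).Dom) : (sum F).Dom :=
  let hg := fun x => Part.get_mem (hF x)
  Part.dom_iff_mem.2 ⟨⟨_, isSigmaHom_of_mem_sum_of_finite hY (fun i => (F i).isSigmaHom) hg⟩,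
    (mem_homSum _ _).2 hg⟩

theorem SigmaHom.sum_dom (hY : IsStrong Y) [Countable ι] (F : ι → SigmaHom X Y)
    (hF : ∀ x, (sum fun i => F i x).Dom) : (sum F).Dom :=
  let hg := fun x => Part.get_mem (hF x)
  Part.dom_iff_mem.2 ⟨⟨_, isSigmaHom_of_mem_sum hY (fun i => (F i).isSigmaHom) hg⟩,
    (mem_homSum _ _).2 hg⟩

theorem holds_sigmaHom {k : Flavour} (hY : k.Holds Y) : k.Holds (SigmaHom X Y) := by
  cases k with
  | weak => exact isInitialSum_eval.isWeak (SigmaHom.sum_dom_of_finite hY) fun _ => hY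
  | strong => exact isInitialSum_eval.isStrong (SigmaHom.sum_dom hY) fun _ => hY
  | finitelyTotal =>
    exact isInitialSum_eval.isFinitelyTotal (SigmaHom.sum_dom_of_finite hY.toIsWeak) fun _ => hY
  | group =>
    obtain ⟨neg, hneg, hhom⟩ := IsSigmaGroup.exists_neg hY
    exact isInitialSum_eval.isSigmaGroup (SigmaHom.sum_dom_of_finite hY.toIsWeak) (fun _ => hY)
      fun f => ⟨⟨fun x => neg (f x), fun _ _ ha => hhom _ _ (f.isSigmaHom _ _ ha)⟩,
        fun x => hneg (f x)⟩

end Hom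

/-! ### The part of a product generated by a family of functions -/

section Generated

variable {S : Type u} {I : Type v} {W : I → Type u} [∀ i, PartialSum (W i)]

/-- The elements of the product of the `W i` generated by the families `φ · s` under componentwise
sums. -/
inductive GeneratedBy (φ : ∀ i, S → W i) : (∀ i, W i) → Prop
  | of (s : S) : GeneratedBy φ (fun i => φ i s)
  | sum {ι : Type} [Countable ι] (a : ι → ∀ i, W i) (t : ∀ i, W i) (ha : ∀ j, GeneratedBy φ (a j))
      (ht : ∀ i, t i ∈ PartialSum.sum (fun j => a j i)) : GeneratedBy φ t

/-- Formal iterated sums of elements of `S`, which bound the number of elements generated by `S`.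
Indexing the sums by sets of natural numbers keeps them in the universe of `S`. -/
inductive SumTerm (S : Type u) : Type u
  | of (s : S) : SumTerm S
  | sum (J : Set ℕ) (a : J → SumTerm S) : SumTerm S

/-- The value of a formal sum, in which undefined sums are given an unspecified value. -/
noncomputable def SumTerm.eval {X : Type u} [PartialSum X] [Nonempty X] (f : S → X) :
    SumTerm S → X
  | .of s => f s
  | .sum _ a => Classical.epsilon fun x => x ∈ PartialSum.sum (fun j => (a j).eval f)

theorem GeneratedBy.exists_sumTerm [∀ i, Nonempty (W i)] {φ : ∀ i, S → W i} {t : ∀ i, W i}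
    (ht : GeneratedBy φ t) : ∃ c : SumTerm S, (fun i => c.eval (φ i)) = t := by
  induction ht with
  | of s => exact ⟨.of s, rfl⟩
  | @sum ι _ a t _ ht ih =>
    choose c hc using ih
    obtain ⟨f, hf⟩ := exists_injective_nat ι
    let e := Equiv.ofInjective f hf
    refine ⟨.sum (Set.range f) fun n => c (e.symm n), funext fun i => ?_⟩
    have hsum : t i ∈ PartialSum.sum (fun n => (c (e.symm n)).eval (φ i)) := by
      rw [mem_sum_reindex e.symm (a := fun j => (c j).eval (φ i))]
      simpa only [← hc] using ht i
    exact Part.mem_unique (Classical.epsilon_spec ⟨_, hsum⟩) hsum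

variable (φ : ∀ i, S → W i)

instance small_generatedBy : Small.{u} {t // GeneratedBy φ t} := by
  rcases isEmpty_or_nonempty {t // GeneratedBy φ t} with _ | ⟨⟨t, -⟩⟩
  · infer_instance
  · have := fun i => Nonempty.intro (t i)
    exact small_subset (s := Set.range fun (c : SumTerm S) i => c.eval (φ i))
      fun _ ht => GeneratedBy.exists_sumTerm ht

/-- The elements of the product of the `W i` generated by the families `φ · s`, in the universe of
the factors even if the index type `I` is large. -/
def Generated : Type u := Shrink.{u} {t // GeneratedBy φ t}

namespace Generated

variable {φ}

/-- The components of an element. -/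
noncomputable def proj (i : I) (t : Generated φ) : W i :=
  ((equivShrink _).symm t).1 i

/-- The element with given components. -/
noncomputable def mk (t : ∀ i, W i) (ht : GeneratedBy φ t) : Generated φ :=
  equivShrink _ ⟨t, ht⟩

theorem proj_mk (t : ∀ i, W i) (ht : GeneratedBy φ t) (i : I) : (mk t ht).proj i = t i := by
  simp only [proj, mk, Equiv.symm_apply_apply]

theorem ext (t t' : Generated φ) (h : ∀ i, t.proj i = t'.proj i) : t = t' :=
  (equivShrink _).symm.injective (Subtype.ext (funext h))

theorem generatedBy (t : Generated φ) : GeneratedBy φ (fun i => t.proj i) :=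
  ((equivShrink _).symm t).2

noncomputable instance : PartialSum (Generated φ) := initialSum proj

theorem isInitialSum_proj : IsInitialSum (proj (φ := φ)) :=
  isInitialSum_initialSum ext

theorem sum_dom {ι : Type} [Countable ι] (a : ι → Generated φ)
    (h : ∀ i, (sum (fun j => (a j).proj i)).Dom) : (sum a).Dom := by
  have ht := fun i => Part.get_mem (h i)
  refine Part.dom_iff_mem.2 ⟨mk _ (.sum _ _ (fun j => (a j).generatedBy) ht), ?_⟩
  rw [isInitialSum_proj.mem_sum_iff]
  intro i
  rw [proj_mk]
  exact ht i

variable (φ) in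
/-- The generators. -/
noncomputable def of (s : S) : Generated φ := mk _ (.of s)

theorem proj_of (s : S) (i : I) : (of φ s).proj i = φ i s := proj_mk _ _ i

theorem induction {P : Generated φ → Prop} (of : ∀ s, P (of φ s))
    (sum : ∀ {ι : Type} [Countable ι] (a : ι → Generated φ) (t : Generated φ),
      (∀ j, P (a j)) → t ∈ sum a → P t) (t : Generated φ) : P t := by
  have h : ∀ t (ht : GeneratedBy φ t), P (mk t ht) := by
    intro t ht
    induction ht with
    | of s => exact of s
    | sum a t ha ht ih =>
      refine sum (fun j => mk (a j) (ha j)) _ ih ((isInitialSum_proj.mem_sum_iff _ _).2 fun i => ?_)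
      simpa only [proj_mk] using ht i
  simpa only [ext (mk _ t.generatedBy) t (proj_mk _ _)] using h _ t.generatedBy

theorem funext_of_isSigmaHom {X : Type u} [PartialSum X] {f g : Generated φ → X}
    (hf : IsSigmaHom f) (hg : IsSigmaHom g) (h : ∀ s, f (of φ s) = g (of φ s)) : f = g := by
  funext t
  induction t using induction with
  | of s => exact h s
  | sum a t ih ht =>
    have hft := hf a t ht
    simp only [ih] at hft
    exact Part.mem_unique hft (hg a t ht)

theorem exists_forall_isNeg (hW : ∀ i, IsSigmaGroup (W i))
    (hφ : ∀ s, ∃ s', ∀ i, IsNeg (φ i s) (φ i s')) (t : Generated φ) :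
    ∃ t' : Generated φ, ∀ i, IsNeg (t.proj i) (t'.proj i) := by
  induction t using induction with
  | of s =>
    obtain ⟨s', hs'⟩ := hφ s
    exact ⟨of φ s', fun i => by simpa only [proj_of] using hs' i⟩
  | sum a t ih ht =>
    choose a' ha' using ih
    choose neg hneg hhom using fun i => (hW i).exists_neg
    have ha'_proj : ∀ j i, (a' j).proj i = neg i ((a j).proj i) := fun j i =>
      (hW i).isNeg_unique (ha' j i) (hneg i _)
    have hsum : ∀ i, neg i (t.proj i) ∈ PartialSum.sum fun j => (a' j).proj i := fun i => by
      simpa only [ha'_proj] using hhom i _ _ (isInitialSum_proj.isSigmaHom i a t ht)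
    obtain ⟨t', ht'⟩ := Part.dom_iff_mem.1 (sum_dom a' fun i => Part.dom_iff_mem.2 ⟨_, hsum i⟩)
    refine ⟨t', fun i => ?_⟩
    rw [Part.mem_unique (isInitialSum_proj.isSigmaHom i a' t' ht') (hsum i)]
    exact hneg i _

theorem holds {k : Flavour} (hW : ∀ i, k.Holds (W i))
    (hφ : k = .group → ∀ s, ∃ s', ∀ i, IsNeg (φ i s) (φ i s')) : k.Holds (Generated φ) := by
  cases k with
  | weak => exact isInitialSum_proj.isWeak sum_dom hW
  | strong => exact isInitialSum_proj.isStrong sum_dom hW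
  | finitelyTotal => exact isInitialSum_proj.isFinitelyTotal sum_dom hW
  | group => exact isInitialSum_proj.isSigmaGroup sum_dom hW (exists_forall_isNeg hW (hφ rfl))

end Generated

end Generated

/-! ### Existence of tensor products -/

section Tensor

variable {k : Flavour} (X Y : SCat.{u} k)

/-- The carrier of the tensor product: what the pure tensors generate in the product of the
codomains of all `Σ`-bilinear functions on `X × Y`. -/
abbrev TensorCarrier : Type u :=
  Generated fun (q : BilinearFrom X Y) (xy : X × Y) => q.map xy.1 xy.2

theorem holds_tensorCarrier : k.Holds (TensorCarrier X Y) := by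
  refine Generated.holds (fun q => q.obj.holds) ?_
  rintro rfl ⟨x, y⟩
  obtain ⟨neg, hneg, -⟩ := IsSigmaGroup.exists_neg X.holds
  exact ⟨(neg x, y), fun q =>
    IsSigmaHom.map_isNeg (f := fun x => q.map x y) (q.map.isSigmaHom_left y) (hneg x)⟩

/-- The tensor product of `X` and `Y`. -/
noncomputable def tensor : BilinearFrom X Y where
  obj := ⟨TensorCarrier X Y, holds_tensorCarrier X Y⟩
  map :=
    { toFun := fun x y => Generated.of _ (x, y)
      isSigmaHom_right := fun x _ _ a y hy => by
        refine (Generated.isInitialSum_proj.mem_sum_iff _ _).2 fun q => ?_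
        simpa only [Generated.proj_of] using q.map.isSigmaHom_right x a y hy
      isSigmaHom_left := fun y _ _ a x hx => by
        refine (Generated.isInitialSum_proj.mem_sum_iff _ _).2 fun q => ?_
        simpa only [Generated.proj_of] using q.map.isSigmaHom_left y a x hx }

theorem isTensorProduct_tensor : (tensor X Y).IsTensorProduct := by
  intro W f
  let q : BilinearFrom X Y := ⟨W, f⟩
  let g : (tensor X Y).obj ⟶ W := ⟨Generated.proj q, Generated.isInitialSum_proj.isSigmaHom q⟩
  have hg : ∀ x y, g ((tensor X Y).map x y) = f x y := fun x y => Generated.proj_of (x, y) q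
  refine ⟨g, hg, fun g' hg' => SigmaHom.ext ?_⟩
  exact Generated.funext_of_isSigmaHom g'.isSigmaHom g.isSigmaHom fun ⟨x, y⟩ =>
    (hg' x y).trans (hg x y).symm

end Tensor

/-! ### The tensor unit represents elements -/

section Unit

variable {k : Flavour}

/-- The generator `1` of the tensor unit. -/
noncomputable def unitOne : (k : Flavour) → unitObj.{u} k
  | .weak => ⟨⟨1, Or.inr rfl⟩⟩
  | .strong => ⟨⟨1, Or.inr rfl⟩⟩
  | .finitelyTotal => ⟨⟨1, show (0 : ℤ) ≤ 1 from zero_le_one⟩⟩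
  | .group => ⟨⟨1, trivial⟩⟩

theorem unitVal_unitOne (k : Flavour) : unitVal (unitOne.{u} k) = 1 := by
  cases k <;> rfl

theorem unitVal_nonneg (hk : k ≠ .group) (n : unitObj.{u} k) : 0 ≤ unitVal n := by
  cases k with
  | weak =>
    have h : unitVal n = 0 ∨ unitVal n = 1 := n.down.2
    lia
  | strong =>
    have h : unitVal n = 0 ∨ unitVal n = 1 := n.down.2
    lia
  | finitelyTotal => exact n.down.2
  | group => exact absurd rfl hk

theorem mem_sum_unitObj {ι : Type} [Countable ι] {a : ι → unitObj.{u} k} {n : unitObj.{u} k} :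
    n ∈ sum a ↔ FinSum (fun i => unitVal (a i)) (unitVal n) := by
  cases k <;> exact mem_unitSum a n

theorem finSum_const (m : ℕ) (c : ℤ) : FinSum (fun _ : Fin m => c) (m * c) :=
  ⟨Set.toFinite _, by
    rw [finsum_eq_sum_of_fintype, Finset.sum_const, Finset.card_univ, Fintype.card_fin,
      nsmul_eq_mul]⟩

theorem isMultiple_unitOne_of_nonneg {n : unitObj.{u} k} (hn : 0 ≤ unitVal n) :
    IsMultiple (unitVal n) (unitOne k) n := by
  refine Or.inl ⟨hn, mem_sum_unitObj.2 ?_⟩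
  simpa only [unitVal_unitOne, mul_one, Int.natAbs_of_nonneg hn] using
    finSum_const (unitVal n).natAbs 1

theorem isMultiple_unitOne_of_neg {n : unitObj.{u} .group} (hn : unitVal n < 0) :
    IsMultiple (unitVal n) (unitOne .group) n := by
  refine Or.inr ⟨hn, ⟨⟨-1, trivial⟩⟩, ⟨⟨⟨0, trivial⟩⟩, mem_sum_unitObj.2 (finSum_empty _), ?_⟩,
    (mem_sum_unitObj (k := .group)).2 ?_⟩
  · refine mem_sum_unitObj.2 ⟨Set.toFinite _, ?_⟩
    rw [finsum_eq_sum_of_fintype, Fin.sum_univ_two]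
    rfl
  · convert finSum_const (unitVal n).natAbs (-1) using 1
    · rfl
    · lia

theorem isMultiple_unitOne (n : unitObj.{u} k) : IsMultiple (unitVal n) (unitOne k) n := by
  by_cases hk : k = .group
  · subst hk
    exact (le_or_gt 0 (unitVal n)).elim isMultiple_unitOne_of_nonneg isMultiple_unitOne_of_neg
  · exact isMultiple_unitOne_of_nonneg (unitVal_nonneg hk n)

theorem isMultiple_unitVal_unique {X : SCat.{u} k} {n : unitObj.{u} k} {x y z : X}
    (hy : IsMultiple (unitVal n) x y) (hz : IsMultiple (unitVal n) x z) : y = z := by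
  refine IsMultiple.unique ?_ hy hz
  by_cases hk : k = .group
  · subst hk
    exact Or.inr (IsSigmaGroup.toIsFinitelyTotal X.holds)
  · exact Or.inl (unitVal_nonneg hk n)

theorem FinSum.nonempty_sigma_fin_equiv {ι : Type} {n : ι → ℕ} {m : ℕ}
    (hn : FinSum (fun i => (n i : ℤ)) m) : Nonempty ((Σ i, Fin (n i)) ≃ Fin m) := by
  have hone : FinSum (fun _ : Σ i, Fin (n i) => (1 : ℤ)) m := by
    refine finSum_flattening _ _ (fun i => by simpa only [mul_one] using finSum_const (n i) 1)
      (hn.1.subset ?_) hn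
    rintro i ⟨j, -⟩
    simpa using j.pos.ne'
  have : Finite (Σ i, Fin (n i)) :=
    Set.finite_univ_iff.1 (hone.1.subset fun _ _ => one_ne_zero)
  let := Fintype.ofFinite (Σ i, Fin (n i))
  refine ⟨Fintype.equivFinOfCardEq ?_⟩
  have hcard := hone.2
  rw [finsum_eq_sum_of_fintype, Finset.sum_const, nsmul_one] at hcard
  exact_mod_cast hcard

theorem IsWeak.mem_sum_of_mem_sum_const {X : Type u} [PartialSum X] (hX : IsWeak X) {x y : X}
    {ι : Type} [Countable ι] {n : ι → ℕ} {m : ℕ} {s : ι → X}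
    (hs : ∀ i, s i ∈ sum (fun _ : Fin (n i) => x)) (hy : y ∈ sum (fun _ : Fin m => x))
    (hn : FinSum (fun i => (n i : ℤ)) m) : y ∈ sum s := by
  obtain ⟨e⟩ := hn.nonempty_sigma_fin_equiv
  exact hX.bracketing (fun _ => x) s hs y ((mem_sum_reindex e (a := fun _ => x)).2 hy)

theorem sum_const_dom (hk : k ≠ .group) (X : SCat.{u} k) (x : X) (n : unitObj.{u} k) :
    (sum (fun _ : Fin (unitVal n).natAbs => x)).Dom := by
  have h_dom_zero_one (hn : unitVal n = 0 ∨ unitVal n = 1) :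
      (sum (fun _ : Fin (unitVal n).natAbs => x)).Dom := by
    rcases hn with hn | hn <;> rw [hn]
    · obtain ⟨z, hz⟩ := X.holds.isWeak.exists_isZero
      exact Part.dom_iff_mem.2 ⟨z, (isZero_iff_mem_sum (fun _ : Fin 0 => x)).1 hz⟩
    · exact Part.dom_iff_mem.2 ⟨x, X.holds.isWeak.mem_sum_of_unique fun _ : Fin 1 => x⟩
  cases k with
  | weak => exact h_dom_zero_one n.down.2
  | strong => exact h_dom_zero_one n.down.2
  | finitelyTotal => exact IsFinitelyTotal.summable_of_finite X.holds _
  | group => exact absurd rfl hk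

theorem exists_hom_unitOne_of_ne_group (hk : k ≠ .group) (X : SCat.{u} k) (x : X) :
    ∃ f : unitObj k ⟶ X, f (unitOne k) = x := by
  have hX := X.holds.isWeak
  choose f hf using fun n => Part.dom_iff_mem.1 (sum_const_dom hk X x n)
  have hval (n : unitObj.{u} k) : ((unitVal n).natAbs : ℤ) = unitVal n :=
    Int.natAbs_of_nonneg (unitVal_nonneg hk n)
  refine ⟨⟨f, fun a n hn => hX.mem_sum_of_mem_sum_const (fun i => hf (a i)) (hf n) ?_⟩, ?_⟩
  · simpa only [hval] using mem_sum_unitObj.1 hn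
  · refine Part.mem_unique (hf (unitOne k)) ?_
    rw [unitVal_unitOne]
    exact hX.mem_sum_of_unique fun _ : Fin 1 => x

theorem exists_hom_unitOne_of_group (X : SCat.{u} .group) (x : X) :
    ∃ f : unitObj .group ⟶ X, f (unitOne .group) = x := by
  have hX : IsSigmaGroup X := X.holds
  obtain ⟨_, hadd⟩ := hX.exists_addCommMonoid
  obtain ⟨neg, hneg, -⟩ := hX.exists_neg
  have hx := hadd.isNeg_iff.1 (hneg x)
  let φ : ℤ →+ X :=
    (AddUnits.coeHom X).comp (zmultiplesHom _ ⟨x, neg x, hx, (add_comm _ _).trans hx⟩)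
  refine ⟨⟨fun n => φ (unitVal n), fun a n hn => ?_⟩, ?_⟩
  · obtain ⟨hfin, hsum⟩ := mem_sum_unitObj.1 hn
    change φ (unitVal n) ∈ _
    rw [← hsum, φ.map_finsum hfin]
    exact hadd.finsum_mem_sum hX.toIsWeak
      (hfin.subset fun i hi h0 => hi ((congrArg φ h0).trans φ.map_zero))
  · change φ (unitVal _) = x
    rw [unitVal_unitOne]
    exact congrArg AddUnits.val (one_zsmul _)

theorem exists_hom_unitOne (X : SCat.{u} k) (x : X) :
    ∃ f : unitObj k ⟶ X, f (unitOne k) = x := by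
  by_cases hk : k = .group
  · subst hk
    exact exists_hom_unitOne_of_group X x
  · exact exists_hom_unitOne_of_ne_group hk X x

end Unit

/-- The internal hom `[X, Y]`. -/
noncomputable abbrev internalHom {k : Flavour} (X Y : SCat.{u} k) : SCat.{u} k :=
  homObj X Y (holds_sigmaHom Y.holds)

/-! ### Operations on `Σ`-bilinear functions -/

namespace SigmaBilinear

variable {X Y Z V W : Type u} [PartialSum X] [PartialSum Y] [PartialSum Z] [PartialSum V]
  [PartialSum W]

/-- Exchange the arguments. -/
def flip (f : SigmaBilinear X Y Z) : SigmaBilinear Y X Z where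
  toFun y x := f x y
  isSigmaHom_right := f.isSigmaHom_left
  isSigmaHom_left := f.isSigmaHom_right

/-- Precompose with a `Σ`-homomorphism in each argument. -/
def precomp (f : SigmaBilinear X Y Z) (g : SigmaHom V X) (h : SigmaHom W Y) :
    SigmaBilinear V W Z where
  toFun v w := f (g v) (h w)
  isSigmaHom_right v _ _ _ _ ha := f.isSigmaHom_right (g v) _ _ (h.isSigmaHom _ _ ha)
  isSigmaHom_left w _ _ _ _ ha := f.isSigmaHom_left (h w) _ _ (g.isSigmaHom _ _ ha)

/-- Postcompose with a `Σ`-homomorphism. -/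
def postcomp (f : SigmaBilinear X Y Z) (g : SigmaHom Z W) : SigmaBilinear X Y W where
  toFun x y := g (f x y)
  isSigmaHom_right x _ _ _ _ ha := g.isSigmaHom _ _ (f.isSigmaHom_right x _ _ ha)
  isSigmaHom_left y _ _ _ _ ha := g.isSigmaHom _ _ (f.isSigmaHom_left y _ _ ha)

/-- A `Σ`-bilinear function as a `Σ`-homomorphism in its first argument. -/
noncomputable def curry (f : SigmaBilinear X Y Z) : SigmaHom X (SigmaHom Y Z) where
  toFun x := ⟨f x, f.isSigmaHom_right x⟩
  isSigmaHom _ _ ha := (mem_homSum _ _).2 fun y => f.isSigmaHom_left y _ _ ha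

/-- The inverse of `SigmaBilinear.curry`. -/
noncomputable def uncurry (g : SigmaHom X (SigmaHom Y Z)) : SigmaBilinear X Y Z where
  toFun x y := g x y
  isSigmaHom_right x := (g x).isSigmaHom
  isSigmaHom_left y _ _ _ _ ha := (mem_homSum _ _).1 (g.isSigmaHom _ _ ha) y

/-- The trilinear function `(x, y, z) ↦ r x (q y z)`, curried in the last argument. -/
noncomputable def curryComp (q : SigmaBilinear Y Z V) (r : SigmaBilinear X V W) :
    SigmaBilinear X Y (SigmaHom Z W) where
  toFun x y := ⟨fun z => r x (q y z), fun _ _ ha =>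
    r.isSigmaHom_right x _ _ (q.isSigmaHom_right y _ _ ha)⟩
  isSigmaHom_right x _ _ _ _ ha := (mem_homSum _ _).2 fun z =>
    r.isSigmaHom_right x _ _ (q.isSigmaHom_left z _ _ ha)
  isSigmaHom_left y _ _ _ _ ha := (mem_homSum _ _).2 fun z => r.isSigmaHom_left (q y z) _ _ ha

variable (X Y) in
/-- Evaluation as a `Σ`-bilinear function. -/
noncomputable def eval : SigmaBilinear X (SigmaHom X Y) Y :=
  (uncurry ⟨id, fun _ _ ha => ha⟩).flip

end SigmaBilinear

/-! ### Morphisms out of tensor products -/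

namespace BilinearFrom.IsTensorProduct

variable {k : Flavour} {X Y Z V W : SCat.{u} k} {T : BilinearFrom X Y}

/-- The `Σ`-homomorphism on a tensor product that corresponds to a `Σ`-bilinear function. -/
noncomputable def desc (hT : T.IsTensorProduct) (f : SigmaBilinear X Y W) : T.obj ⟶ W :=
  (hT W f).choose

@[simp]
theorem desc_map (hT : T.IsTensorProduct) (f : SigmaBilinear X Y W) (x : X) (y : Y) :
    hT.desc f (T.map x y) = f x y :=
  (hT W f).choose_spec.1 x y

theorem hom_ext (hT : T.IsTensorProduct) {f g : T.obj ⟶ W}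
    (h : ∀ x y, f (T.map x y) = g (T.map x y)) : f = g :=
  (hT W (T.map.postcomp g)).unique h fun _ _ => rfl

theorem hom_ext_curry (hT : T.IsTensorProduct) {f g : T.obj ⟶ W}
    (h : (T.map.postcomp f).curry = (T.map.postcomp g).curry) : f = g :=
  hT.hom_ext fun x y => DFunLike.congr_fun (DFunLike.congr_fun h x) y

theorem hom_ext_curry_flip (hT : T.IsTensorProduct) {f g : T.obj ⟶ W}
    (h : (T.map.postcomp f).flip.curry = (T.map.postcomp g).flip.curry) : f = g :=
  hT.hom_ext fun x y => DFunLike.congr_fun (DFunLike.congr_fun h y) x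

theorem hom_ext₃ (hT : T.IsTensorProduct) {S : BilinearFrom T.obj Z} (hS : S.IsTensorProduct)
    {f g : S.obj ⟶ W} (h : ∀ x y z, f (S.map (T.map x y) z) = g (S.map (T.map x y) z)) : f = g :=
  hS.hom_ext_curry <| hT.hom_ext (W := internalHom Z W) fun x y => SigmaHom.ext (funext (h x y))

theorem hom_ext₃' {T : BilinearFrom Y Z} (hT : T.IsTensorProduct) {S : BilinearFrom X T.obj}
    (hS : S.IsTensorProduct) {f g : S.obj ⟶ W}
    (h : ∀ x y z, f (S.map x (T.map y z)) = g (S.map x (T.map y z))) : f = g :=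
  hS.hom_ext_curry_flip <| hT.hom_ext (W := internalHom X W) fun y z =>
    SigmaHom.ext (funext fun x => h x y z)

theorem hom_ext₄ (hT : T.IsTensorProduct) {S : BilinearFrom T.obj Z} (hS : S.IsTensorProduct)
    {R : BilinearFrom S.obj V} (hR : R.IsTensorProduct) {f g : R.obj ⟶ W}
    (h : ∀ x y z v, f (R.map (S.map (T.map x y) z) v) = g (R.map (S.map (T.map x y) z) v)) :
    f = g :=
  hR.hom_ext_curry <| hT.hom_ext₃ (W := internalHom V W) hS fun x y z =>
    SigmaHom.ext (funext (h x y z))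

/-- Extend a trilinear function, curried in the last argument, to a bilinear one on the tensor
product of the first two factors. -/
noncomputable def desc₃ (hT : T.IsTensorProduct) (f : SigmaBilinear X Y (SigmaHom Z W)) :
    SigmaBilinear T.obj Z W :=
  .uncurry (hT.desc (W := internalHom Z W) f)

@[simp]
theorem desc₃_map (hT : T.IsTensorProduct) (f : SigmaBilinear X Y (SigmaHom Z W)) (x : X) (y : Y)
    (z : Z) : hT.desc₃ f (T.map x y) z = f x y z :=
  congrArg (fun g : SigmaHom Z W => g z) (hT.desc_map (W := internalHom Z W) f x y)

end BilinearFrom.IsTensorProduct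

/-! ### The action of the tensor unit -/

section UnitAction

variable {k : Flavour}

/-- The action `(n, x) ↦ n · x` of the tensor unit on an object. -/
noncomputable def unitAction (X : SCat.{u} k) : SigmaBilinear (unitObj.{u} k) X X :=
  .uncurry (exists_hom_unitOne (internalHom X X) (𝟙 X)).choose

@[simp]
theorem unitAction_unitOne (X : SCat.{u} k) (x : X) : unitAction X (unitOne k) x = x :=
  congrArg (fun f : SigmaHom X X => f x)
    (exists_hom_unitOne (internalHom X X) (𝟙 X)).choose_spec

theorem isMultiple_unitAction (X : SCat.{u} k) (n : unitObj.{u} k) (x : X) :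
    IsMultiple (unitVal n) x (unitAction X n x) := by
  simpa only [unitAction_unitOne] using
    IsSigmaHom.map_isMultiple (f := fun n => unitAction X n x) ((unitAction X).isSigmaHom_left x)
      (isMultiple_unitOne n)

theorem map_unitAction {X Y : SCat.{u} k} (f : X ⟶ Y) (n : unitObj.{u} k) (x : X) :
    f (unitAction X n x) = unitAction Y n (f x) :=
  isMultiple_unitVal_unique (IsSigmaHom.map_isMultiple f.isSigmaHom (isMultiple_unitAction X n x))
    (isMultiple_unitAction Y n (f x))

theorem map_unitAction_left {X Y : SCat.{u} k} (T : BilinearFrom X Y) (n : unitObj.{u} k) (x : X)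
    (y : Y) : T.map (unitAction X n x) y = unitAction T.obj n (T.map x y) :=
  map_unitAction (Y := T.obj) (T.map.flip.curry y) n x

theorem map_unitAction_right {X Y : SCat.{u} k} (T : BilinearFrom X Y) (n : unitObj.{u} k) (x : X)
    (y : Y) : T.map x (unitAction Y n y) = unitAction T.obj n (T.map x y) :=
  map_unitAction (Y := T.obj) (T.map.curry x) n y

theorem unitAction_unitOne_right (n : unitObj.{u} k) : unitAction (unitObj k) n (unitOne k) = n :=
  isMultiple_unitVal_unique (isMultiple_unitAction _ _ _) (isMultiple_unitOne n)

end UnitAction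

/-! ### Structure morphisms -/

section Structure

variable {k : Flavour} {T : (X Y : SCat.{u} k) → BilinearFrom X Y}
  (hT : ∀ X Y, (T X Y).IsTensorProduct) {X Y Z X' Y' Z' : SCat.{u} k}

/-- The tensor product `f ⊗ g` of two morphisms. -/
noncomputable def tensorMap (f : X ⟶ X') (g : Y ⟶ Y') : (T X Y).obj ⟶ (T X' Y').obj :=
  (hT X Y).desc ((T X' Y').map.precomp f g)

@[simp]
theorem tensorMap_map (f : X ⟶ X') (g : Y ⟶ Y') (x : X) (y : Y) :
    tensorMap hT f g ((T X Y).map x y) = (T X' Y').map (f x) (g y) :=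
  (hT X Y).desc_map _ x y

theorem tensorMap_id (X Y : SCat.{u} k) : tensorMap hT (𝟙 X) (𝟙 Y) = 𝟙 (T X Y).obj :=
  (hT X Y).hom_ext (tensorMap_map hT (𝟙 X) (𝟙 Y))

theorem tensorMap_comp_tensorMap {X'' Y'' : SCat.{u} k} (f : X ⟶ X') (g : Y ⟶ Y')
    (f' : X' ⟶ X'') (g' : Y' ⟶ Y'') :
    tensorMap hT f g ≫ tensorMap hT f' g' = tensorMap hT (f ≫ f') (g ≫ g') :=
  (hT X Y).hom_ext fun x y => by simp

/-- The associator. -/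
noncomputable def assocHom (X Y Z : SCat.{u} k) : (T (T X Y).obj Z).obj ⟶ (T X (T Y Z).obj).obj :=
  (hT _ Z).desc ((hT X Y).desc₃ ((T Y Z).map.curryComp (T X (T Y Z).obj).map))

@[simp]
theorem assocHom_map (x : X) (y : Y) (z : Z) :
    assocHom hT X Y Z ((T _ Z).map ((T X Y).map x y) z) = (T X _).map x ((T Y Z).map y z) :=
  ((hT _ Z).desc_map _ _ z).trans ((hT X Y).desc₃_map _ x y z)

/-- The inverse of the associator. -/
noncomputable def assocInv (X Y Z : SCat.{u} k) : (T X (T Y Z).obj).obj ⟶ (T (T X Y).obj Z).obj :=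
  (hT X _).desc
    ((hT Y Z).desc₃ ((T X Y).map.flip.curryComp (T (T X Y).obj Z).map.flip).flip).flip

@[simp]
theorem assocInv_map (x : X) (y : Y) (z : Z) :
    assocInv hT X Y Z ((T X _).map x ((T Y Z).map y z)) = (T _ Z).map ((T X Y).map x y) z :=
  ((hT X _).desc_map _ x _).trans ((hT Y Z).desc₃_map _ y z x)

/-- The associator as an isomorphism. -/
noncomputable def assocIso (X Y Z : SCat.{u} k) :
    (T (T X Y).obj Z).obj ≅ (T X (T Y Z).obj).obj where
  hom := assocHom hT X Y Z
  inv := assocInv hT X Y Z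
  hom_inv_id := (hT X Y).hom_ext₃ (hT _ Z) fun x y z => by simp
  inv_hom_id := (hT Y Z).hom_ext₃' (hT X _) fun x y z => by simp

/-- The left unitor, with inverse `x ↦ p(1, x)`. -/
noncomputable def leftUnitorIso (X : SCat.{u} k) : (T (unitObj k) X).obj ≅ X where
  hom := (hT _ X).desc (unitAction X)
  inv := (T (unitObj k) X).map.curry (unitOne k)
  hom_inv_id := (hT _ X).hom_ext fun n x => by
    change (T (unitObj k) X).map (unitOne k) ((hT _ X).desc (unitAction X) _) = _
    rw [(hT _ X).desc_map, map_unitAction_right, ← map_unitAction_left, unitAction_unitOne_right,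
      id_apply]
  inv_hom_id := SigmaHom.ext <| funext fun x =>
    ((hT _ X).desc_map _ (unitOne k) x).trans (unitAction_unitOne X x)

@[simp]
theorem leftUnitorIso_hom_map (n : unitObj.{u} k) (x : X) :
    (leftUnitorIso hT X).hom ((T _ X).map n x) = unitAction X n x :=
  (hT _ X).desc_map _ n x

/-- The right unitor, with inverse `x ↦ p(x, 1)`. -/
noncomputable def rightUnitorIso (X : SCat.{u} k) : (T X (unitObj k)).obj ≅ X where
  hom := (hT X _).desc (unitAction X).flip
  inv := (T X (unitObj k)).map.flip.curry (unitOne k)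
  hom_inv_id := (hT X _).hom_ext fun x n => by
    change (T X (unitObj k)).map ((hT X _).desc (unitAction X).flip _) (unitOne k) = _
    rw [(hT X _).desc_map]
    change (T X (unitObj k)).map (unitAction X n x) _ = _
    rw [map_unitAction_left, ← map_unitAction_right, unitAction_unitOne_right, id_apply]
  inv_hom_id := SigmaHom.ext <| funext fun x =>
    ((hT X _).desc_map _ x (unitOne k)).trans (unitAction_unitOne X x)

@[simp]
theorem rightUnitorIso_hom_map (x : X) (n : unitObj.{u} k) :
    (rightUnitorIso hT X).hom ((T X _).map x n) = unitAction X n x :=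
  (hT X _).desc_map _ x n

/-- The braiding. -/
noncomputable def braidHom (X Y : SCat.{u} k) : (T X Y).obj ⟶ (T Y X).obj :=
  (hT X Y).desc (T Y X).map.flip

@[simp]
theorem braidHom_map (x : X) (y : Y) : braidHom hT X Y ((T X Y).map x y) = (T Y X).map y x :=
  (hT X Y).desc_map _ x y

/-- The braiding as an isomorphism. -/
noncomputable def braidIso (X Y : SCat.{u} k) : (T X Y).obj ≅ (T Y X).obj where
  hom := braidHom hT X Y
  inv := braidHom hT Y X
  hom_inv_id := (hT X Y).hom_ext fun x y => by simp
  inv_hom_id := (hT Y X).hom_ext fun y x => by simp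

/-! ### Coherence -/

theorem assocHom_naturality (f : X ⟶ X') (g : Y ⟶ Y') (h : Z ⟶ Z') :
    tensorMap hT (tensorMap hT f g) h ≫ assocHom hT X' Y' Z' =
      assocHom hT X Y Z ≫ tensorMap hT f (tensorMap hT g h) :=
  (hT X Y).hom_ext₃ (hT _ Z) fun x y z => by simp

theorem leftUnitorIso_hom_naturality (f : X ⟶ Y) :
    tensorMap hT (𝟙 (unitObj k)) f ≫ (leftUnitorIso hT Y).hom = (leftUnitorIso hT X).hom ≫ f :=
  (hT _ X).hom_ext fun n x => by simp [map_unitAction]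

theorem rightUnitorIso_hom_naturality (f : X ⟶ Y) :
    tensorMap hT f (𝟙 (unitObj k)) ≫ (rightUnitorIso hT Y).hom = (rightUnitorIso hT X).hom ≫ f :=
  (hT X _).hom_ext fun x n => by simp [map_unitAction]

theorem assocHom_pentagon (W X Y Z : SCat.{u} k) :
    tensorMap hT (assocHom hT W X Y) (𝟙 Z) ≫ assocHom hT W (T X Y).obj Z ≫
        tensorMap hT (𝟙 W) (assocHom hT X Y Z) =
      assocHom hT (T W X).obj Y Z ≫ assocHom hT W X (T Y Z).obj :=
  (hT W X).hom_ext₄ (hT _ Y) (hT _ Z) fun w x y z => by simp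

theorem assocHom_triangle (X Y : SCat.{u} k) :
    assocHom hT X (unitObj k) Y ≫ tensorMap hT (𝟙 X) (leftUnitorIso hT Y).hom =
      tensorMap hT (rightUnitorIso hT X).hom (𝟙 Y) :=
  (hT X _).hom_ext₃ (hT _ Y) fun x n y => by simp [map_unitAction_left, map_unitAction_right]

theorem braidHom_naturality (f : X ⟶ X') (g : Y ⟶ Y') :
    tensorMap hT f g ≫ braidHom hT X' Y' = braidHom hT X Y ≫ tensorMap hT g f :=
  (hT X Y).hom_ext fun x y => by simp

theorem braidHom_hexagon_forward (X Y Z : SCat.{u} k) :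
    assocHom hT X Y Z ≫ braidHom hT X (T Y Z).obj ≫ assocHom hT Y Z X =
      tensorMap hT (braidHom hT X Y) (𝟙 Z) ≫ assocHom hT Y X Z ≫
        tensorMap hT (𝟙 Y) (braidHom hT X Z) :=
  (hT X Y).hom_ext₃ (hT _ Z) fun x y z => by simp

theorem braidHom_hexagon_reverse (X Y Z : SCat.{u} k) :
    assocInv hT X Y Z ≫ braidHom hT (T X Y).obj Z ≫ assocInv hT Z X Y =
      tensorMap hT (𝟙 X) (braidHom hT Y Z) ≫ assocInv hT X Z Y ≫
        tensorMap hT (braidHom hT X Z) (𝟙 Y) :=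
  (hT Y Z).hom_ext₃' (hT X _) fun x y z => by simp

/-! ### Evaluation and coevaluation -/

/-- The internal hom functor `[X, -]`. -/
noncomputable def homFunctor (X : SCat.{u} k) : SCat.{u} k ⥤ SCat.{u} k where
  obj Y := internalHom X Y
  map {Y _} g := ((SigmaBilinear.eval X Y).postcomp g).flip.curry

/-- The evaluation morphism. -/
noncomputable def evalHom (X Y : SCat.{u} k) : (T X (internalHom X Y)).obj ⟶ Y :=
  (hT X _).desc (SigmaBilinear.eval X Y)

theorem evalHom_map (x : X) (f : SigmaHom X Y) :
    evalHom hT X Y ((T X (internalHom X Y)).map x f) = f x :=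
  (hT X (internalHom X Y)).desc_map (SigmaBilinear.eval X Y) x f

theorem evalHom_naturality (X : SCat.{u} k) (g : Y ⟶ Z) :
    tensorMap hT (𝟙 X) ((homFunctor X).map g) ≫ evalHom hT X Z = evalHom hT X Y ≫ g :=
  (hT X _).hom_ext fun x (f : SigmaHom X Y) => calc
    evalHom hT X Z (tensorMap hT (𝟙 X) ((homFunctor X).map g) ((T X _).map x f))
    _ = evalHom hT X Z ((T X _).map x ((homFunctor X).map g f)) :=
      congrArg _ (tensorMap_map hT (𝟙 X) ((homFunctor X).map g) x f)
    _ = g (f x) := evalHom_map hT x _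
    _ = g (evalHom hT X Y ((T X _).map x f)) := congrArg g (evalHom_map hT x f).symm

/-- The coevaluation morphism. -/
noncomputable def coevalHom (T : (X Y : SCat.{u} k) → BilinearFrom X Y) (X Y : SCat.{u} k) :
    Y ⟶ internalHom X (T X Y).obj :=
  (T X Y).map.flip.curry

theorem coevalHom_naturality (X : SCat.{u} k) (g : Y ⟶ Z) :
    g ≫ coevalHom T X Z = coevalHom T X Y ≫ (homFunctor X).map (tensorMap hT (𝟙 X) g) :=
  SigmaHom.ext <| funext fun y => SigmaHom.ext <| funext fun x =>
    (tensorMap_map hT (𝟙 X) g x y).symm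

theorem tensorMap_coevalHom_comp_evalHom (X Y : SCat.{u} k) :
    tensorMap hT (𝟙 X) (coevalHom T X Y) ≫ evalHom hT X (T X Y).obj = 𝟙 (T X Y).obj :=
  (hT X Y).hom_ext fun x y =>
    (congrArg (evalHom hT X (T X Y).obj) (tensorMap_map hT (𝟙 X) (coevalHom T X Y) x y)).trans
      (evalHom_map hT x _)

theorem coevalHom_comp_map_evalHom (X Y : SCat.{u} k) :
    coevalHom T X (internalHom X Y) ≫ (homFunctor X).map (evalHom hT X Y) = 𝟙 (internalHom X Y) :=
  SigmaHom.ext <| funext fun f => SigmaHom.ext <| funext fun x => evalHom_map hT x f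

/-! ### The closed symmetric monoidal category -/

/-- The monoidal category given by a choice of tensor products. -/
noncomputable abbrev monoidalCategory : MonoidalCategory (SCat.{u} k) :=
  letI : MonoidalCategoryStruct (SCat.{u} k) :=
    { tensorObj X Y := (T X Y).obj
      whiskerLeft X _ _ f := tensorMap hT (𝟙 X) f
      whiskerRight f Y := tensorMap hT f (𝟙 Y)
      tensorHom f g := tensorMap hT f g
      tensorUnit := unitObj k
      associator := assocIso hT
      leftUnitor := leftUnitorIso hT
      rightUnitor := rightUnitorIso hT }
  .ofTensorHom
    (id_tensorHom_id := tensorMap_id hT)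
    (id_tensorHom := fun _ _ _ _ => rfl)
    (tensorHom_id := fun _ _ => rfl)
    (tensorHom_comp_tensorHom := tensorMap_comp_tensorMap hT)
    (associator_naturality := assocHom_naturality hT)
    (leftUnitor_naturality := leftUnitorIso_hom_naturality hT)
    (rightUnitor_naturality := rightUnitorIso_hom_naturality hT)
    (pentagon := assocHom_pentagon hT)
    (triangle := assocHom_triangle hT)

/-- The symmetry given by a choice of tensor products. -/
noncomputable abbrev symmetricCategory :
    letI := monoidalCategory hT
    SymmetricCategory (SCat.{u} k) :=
  letI := monoidalCategory hT
  { braiding := braidIso hT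
    braiding_naturality_right := fun X _ _ f => braidHom_naturality hT (𝟙 X) f
    braiding_naturality_left := fun f Z => braidHom_naturality hT f (𝟙 Z)
    hexagon_forward := braidHom_hexagon_forward hT
    hexagon_reverse := braidHom_hexagon_reverse hT
    symmetry := fun X Y => (braidIso hT X Y).hom_inv_id }

/-- The closed structure given by a choice of tensor products. -/
noncomputable abbrev monoidalClosed :
    letI := monoidalCategory hT
    MonoidalClosed (SCat.{u} k) :=
  letI := monoidalCategory hT
  { closed := fun X =>
    { rightAdj := homFunctor X
      adj :=
      { unit :=
        { app := coevalHom T X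
          naturality := fun _ _ => coevalHom_naturality hT X }
        counit :=
        { app := evalHom hT X
          naturality := fun _ _ => evalHom_naturality hT X }
        left_triangle_components := tensorMap_coevalHom_comp_evalHom hT X
        right_triangle_components := coevalHom_comp_map_evalHom hT X } } }

theorem isMultiple_leftUnitorIso_hom_map (n : unitObj.{u} k) (x : X) :
    IsMultiple (unitVal n) x ((leftUnitorIso hT X).hom ((T _ X).map n x)) := by
  simpa only [leftUnitorIso_hom_map] using isMultiple_unitAction X n x

theorem isMultiple_rightUnitorIso_hom_map (n : unitObj.{u} k) (x : X) :
    IsMultiple (unitVal n) x ((rightUnitorIso hT X).hom ((T X _).map x n)) := by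
  simpa only [rightUnitorIso_hom_map] using isMultiple_unitAction X n x

end Structure

end SigmaMonoid

theorem mainTheorem7 (k : SigmaMonoid.Flavour) :
    (∀ X Y : SigmaMonoid.SCat.{u} k,
      ∃ T : SigmaMonoid.BilinearFrom X Y, T.IsTensorProduct) ∧
    ∃ hH : ∀ X Y : SigmaMonoid.SCat.{u} k, k.Holds (SigmaMonoid.SigmaHom X Y),
    ∀ T : (X Y : SigmaMonoid.SCat.{u} k) → SigmaMonoid.BilinearFrom X Y,
      (∀ X Y, (T X Y).IsTensorProduct) →
      ∃ (_ : MonoidalCategory (SigmaMonoid.SCat.{u} k))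
        (_ : SymmetricCategory (SigmaMonoid.SCat.{u} k))
        (_ : MonoidalClosed (SigmaMonoid.SCat.{u} k))
        (p : (X Y : SigmaMonoid.SCat.{u} k) →
          SigmaMonoid.SigmaBilinear X Y (X ⊗ Y : SigmaMonoid.SCat.{u} k))
        (hI : 𝟙_ (SigmaMonoid.SCat.{u} k) = SigmaMonoid.unitObj.{u} k)
        (hHom : ∀ X Y : SigmaMonoid.SCat.{u} k,
          (ihom X).obj Y = SigmaMonoid.homObj X Y (hH X Y)),
        -- the monoidal product on objects is the given tensor product
        (∀ X Y : SigmaMonoid.SCat.{u} k, SigmaMonoid.BilinearFrom.mk (X ⊗ Y) (p X Y) = T X Y) ∧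
        -- the monoidal product on morphisms
        (∀ {X Y Z W : SigmaMonoid.SCat.{u} k} (f : X ⟶ Z) (g : Y ⟶ W) (x : X) (y : Y),
          (f ⊗ₘ g) (p X Y x y) = p Z W (f x) (g y)) ∧
        -- unitors
        (∀ (X : SigmaMonoid.SCat.{u} k) (n : SigmaMonoid.unitObj.{u} k) (x : X),
          SigmaMonoid.IsMultiple (SigmaMonoid.unitVal n) x
            ((λ_ X).hom (p (𝟙_ _) X (eqToHom hI.symm n) x))) ∧
        (∀ (X : SigmaMonoid.SCat.{u} k) (n : SigmaMonoid.unitObj.{u} k) (x : X),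
          SigmaMonoid.IsMultiple (SigmaMonoid.unitVal n) x
            ((ρ_ X).hom (p X (𝟙_ _) x (eqToHom hI.symm n)))) ∧
        -- associator
        (∀ (X Y Z : SigmaMonoid.SCat.{u} k) (x : X) (y : Y) (z : Z),
          (α_ X Y Z).hom (p (X ⊗ Y) Z (p X Y x y) z) = p X (Y ⊗ Z) x (p Y Z y z)) ∧
        -- symmetry
        (∀ (X Y : SigmaMonoid.SCat.{u} k) (x : X) (y : Y),
          (β_ X Y).hom (p X Y x y) = p Y X y x) ∧
        -- the counit of the closed structure is evaluation
        (∀ (X Y : SigmaMonoid.SCat.{u} k) (x : X) (h : SigmaMonoid.SigmaHom X Y),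
          (ihom.ev X).app Y (p X ((ihom X).obj Y) x
            (eqToHom (hHom X Y).symm h)) = h x) := by
  refine ⟨fun X Y => ⟨SigmaMonoid.tensor X Y, SigmaMonoid.isTensorProduct_tensor X Y⟩,
    fun X Y => SigmaMonoid.holds_sigmaHom Y.holds, fun T hT => ?_⟩
  exact ⟨SigmaMonoid.monoidalCategory hT, SigmaMonoid.symmetricCategory hT,
    SigmaMonoid.monoidalClosed hT, fun X Y => (T X Y).map, rfl, fun _ _ => rfl, fun _ _ => rfl,
    SigmaMonoid.tensorMap_map hT,
    fun _ => SigmaMonoid.isMultiple_leftUnitorIso_hom_map hT,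
    fun _ => SigmaMonoid.isMultiple_rightUnitorIso_hom_map hT,
    fun _ _ _ => SigmaMonoid.assocHom_map hT, fun _ _ => SigmaMonoid.braidHom_map hT,
    fun _ _ => SigmaMonoid.evalHom_map hT⟩
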